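/- **Setting.** A triple $\mathbf q=(q_1,q,q_2)$ consists of nonzero complex numbers; it is drawn as the generalized Dynkin diagram with two vertices labelled $q_1,q_2$ and an edge labelled $q$. For $i=1,2$ let $$m_i:=\min\{m\in\mathbb N_0\mid 1+q_i+\dots+q_i^m=0\ \text{ or }\ q_i^m q=1\},$$ if this set is nonempty ($m_i$ is then called defined), and put $$\sigma_1(\mathbf q)=(q_1,\;q_1^{-2m_1}q^{-1},\;q_1^{m_1^2}q^{m_1}q_2),\qquad \sigma_2(\mathbf q)=(q_1q^{m_2}q_2^{m_2^2},\;q_2^{-2m_2}q^{-1},\;q_2).$$ Where defined, $\sigma_i$ is an involution preserving $m_i$. If all integers needed are defined, applying $\sigma_1,\sigma_2$ alternately gives a bi-infinite sequence of triples $(\mathbf q_i)_{i\in\mathbb Z}$ with $\mathbf q_0=\mathbf q$, where $\mathbf q_i$ and $\mathbf q_{i+1}$ are exchanged by $\sigma_1$ for even $i$ and by $\sigma_2$ for odd $i$. The *characteristic sequence* of $\mathbf q$ is $(c_i)_{i\in\mathbb Z}$, where $c_i$ is the integer $m_1$ (for $i$ even), respectively $m_2$ (for $i$ odd), of $\mathbf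 q_i$ (equivalently, of $\mathbf q_{i+1}$). If some needed integer is not defined, $\mathbf q$ is *broken* and has no characteristic sequence. *Quiddity cycles* are the finite sequences, up to rotation and reversal, obtained from $(0,0)$ by repeatedly replacing $(c_1,\dots,c_n)$ by $(c_1+1,1,c_2+1,c_3,\dots,c_n)$. A sequence $(c_i)_{i\in\mathbb Z}$ is *affine* if there are representatives $(c'_{k,1},\dots,c'_{k,r_k})$, $r_k\ge 2$, $k\in\mathbb Z$, of quiddity cycles and integers $p_k$ with $p_{k+1}=p_k+r_k-1$ such that, for all $k$, $c_{p_k}=c'_{k-1,r_{k-1}}+2+c'_{k,1}$ and $c_{p_k+j}=c'_{k,j+1}$ for $0<j<r_k-1$. A triple is *affine* if it is not broken and its characteristic sequence is affine. Let $\mu_n$ be the set of primitive $n$-th roots of unity in $\mathbb C$. **Theorem.** A triple $\mathbf q=(q_1,q,q_2)$ of nonzero complex numbers is affine if and only if $(q_1,q,q_2)$ or $(q_2,q,q_1)$ is one of the triples in the following table. In that case the characteristic sequence of $\mathbf q$ is periodic; up to a shift of the index it is the bi-infinite repetition of the word in the last column. | | triples | parameters | period | |---|---|---|---| | 1 | $(\zeta,\zeta,\zeta)$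 | $\zeta\in\mu_3$ | $(2)$ | | 2 | $(\zeta^2,\zeta^5,\zeta^2)$ | $\zeta\in\mu_6$ | $(2)$ | | 3 | $(\zeta,\zeta^4,\zeta^4)$ | $\zeta\in\mu_6$ | $(2)$ | | 4 | $(\zeta^4,\zeta,\zeta^2)$, $(\zeta^2,\zeta^3,\zeta^2)$, $(\zeta^2,\zeta,\zeta^4)$ | $\zeta\in\mu_6$ | $(2)$ | | 5 | $(\zeta,\zeta^{10},\zeta^4)$ | $\zeta\in\mu_{12}$ | $(2)$ | | 6 | $(\zeta,\zeta^4,\zeta^4)$ | $\zeta\in\mu_5$ | $(1,4)$ | | 7 | $(\zeta^4,\zeta^4,\zeta)$ | $\zeta\in\mu_8$ | $(1,4)$ | | 8 | $(\zeta,\zeta^9,\zeta^4)$ | $\zeta\in\mu_{10}$ | $(1,4)$ | | 9 | $(\zeta,\zeta^{10},\zeta^9)$, $(\zeta^9,\zeta^8,\zeta^4)$ | $\zeta\in\mu_{12}$ | $(2,3,1,3)$ | | 10 | $(\zeta,\zeta^8,\zeta^6)$, $(\zeta^6,\zeta^4,\zeta^3)$, $(\zeta^3,\zeta^2,\zeta^9)$,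 $(\zeta^9,\zeta^4,\zeta^6)$, $(\zeta^6,\zeta^8,\zeta^7)$ | $\zeta\in\mu_{12}$ | $(4,1,3,3,1)$ | | 11 | $(\zeta,\zeta^{12},\zeta^9)$, $(\zeta^9,\zeta^6,\zeta^4)$ | $\zeta\in\mu_{18}$ | $(6,1,3,1)$ | | 12 | $(q,q^{-2},q)$ | $q\in\mathbb C^\times\setminus\{\pm1\}$ | $(2)$ | | 13 | $(q,q^{-2},-q)$ | $q\in\mathbb C^\times\setminus\{\pm1\}$ | $(2)$ | | 14 | $(q,q^{-4},q^4)$ | $q\in\mathbb C^\times\setminus\{\pm1\}$, $q\notin\mu_3$, $q\notin\mu_4$ | $(1,4)$ | -/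

import Mathlib

/-- A triple `(q₁, q, q₂)` of invertible elements of a commutative ring, i.e. the invariant of a
bicharacter of rank two. -/
@[ext]
structure BicharTriple (R : Type*) [CommRing R] where
  q₁ : Rˣ
  q : Rˣ
  q₂ : Rˣ

namespace BicharTriple

variable {R : Type*} [CommRing R]

/-- Exchange of the two labels. -/
def swap (t : BicharTriple R) : BicharTriple R := ⟨t.q₂, t.q, t.q₁⟩

/-- `m` is the minimum of the set of all `m ∈ ℕ₀` with `1 + a + ⋯ + a ^ m = 0` or `a ^ m q = 1`.
(If that set is empty then no `m` has this property: the integer is not defined.) -/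
def IsCartanEntry (a q : Rˣ) (m : ℕ) : Prop :=
  IsLeast {m : ℕ | ∑ i ∈ Finset.range (m + 1), (a : R) ^ i = 0 ∨ a ^ m * q = 1} m

/-- `m₁` of the triple `t` is defined and equals `m`, and `t' = σ₁(t)`. -/
def Reflects₁ (m : ℕ) (t t' : BicharTriple R) : Prop :=
  IsCartanEntry t.q₁ t.q m ∧
    t' = ⟨t.q₁, (t.q₁ ^ (2 * m))⁻¹ * t.q⁻¹, t.q₁ ^ (m ^ 2) * t.q ^ m * t.q₂⟩

/-- `m₂` of the triple `t` is defined and equals `m`, and `t' = σ₂(t)`. -/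
def Reflects₂ (m : ℕ) (t t' : BicharTriple R) : Prop :=
  IsCartanEntry t.q₂ t.q m ∧
    t' = ⟨t.q₁ * t.q ^ m * t.q₂ ^ (m ^ 2), (t.q₂ ^ (2 * m))⁻¹ * t.q⁻¹, t.q₂⟩

/-- `c` is the characteristic sequence of `t`: there is a bi-infinite sequence of triples
`⋯ ↔ T (-1) ↔ T 0 = t ↔ T 1 ↔ ⋯`, where the step between `T i` and `T (i + 1)` is `σ₁` for even `i`
and `σ₂` for odd `i` (in both directions), with associated integer `c i`.
A broken triple has no characteristic sequence. -/
def IsCharSeq (t : BicharTriple R) (c : ℤ → ℕ) : Prop :=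
  ∃ T : ℤ → BicharTriple R, T 0 = t ∧
    (∀ i : ℤ, Even i →
      Reflects₁ (c i) (T i) (T (i + 1)) ∧ Reflects₁ (c i) (T (i + 1)) (T i)) ∧
    (∀ i : ℤ, Odd i →
      Reflects₂ (c i) (T i) (T (i + 1)) ∧ Reflects₂ (c i) (T (i + 1)) (T i))

end BicharTriple

/-- `IsQuiddity l`: the list `l` is a representative of a quiddity cycle. Quiddity cycles are
taken up to the action of the dihedral group, whence `rotate` and `reverse`. -/
inductive IsQuiddity : List ℕ → Prop
  | base : IsQuiddity [0, 0]
  | ear (a b : ℕ) (l : List ℕ) :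
      IsQuiddity (a :: b :: l) → IsQuiddity ((a + 1) :: 1 :: (b + 1) :: l)
  | rotate (a : ℕ) (l : List ℕ) : IsQuiddity (a :: l) → IsQuiddity (l ++ [a])
  | reverse (l : List ℕ) : IsQuiddity l → IsQuiddity l.reverse

/-- A bi-infinite sequence is affine if it is obtained by gluing representatives `C k`, `k ∈ ℤ`, of
quiddity cycles: the last entry of `C (k - 1)` and the first entry of `C k` share one position
`p k`, where the sequence has the value (last entry of `C (k - 1)`) `+ 2 +` (first entry of `C k`);
the inner entries of `C k` stand between the positions `p k` and `p (k + 1)`. -/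
def IsAffineSeq (c : ℤ → ℕ) : Prop :=
  ∃ (C : ℤ → List ℕ) (p : ℤ → ℤ), ∀ k : ℤ,
    IsQuiddity (C k) ∧ 2 ≤ (C k).length ∧
    p (k + 1) = p k + ((C k).length - 1 : ℤ) ∧
    c (p k) = (C (k - 1)).getLastD 0 + 2 + (C k).headD 0 ∧
    ∀ j : ℕ, 0 < j → j + 1 < (C k).length → c (p k + j) = (C k).getD j 0

/-- `c` is periodic, and (up to the choice of the starting position) it is the repetition of the
word `w`. -/
def HasPeriodWord (c : ℤ → ℕ) (w : List ℕ) : Prop :=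
  ∃ s : ℤ, ∀ (n : ℤ) (j : ℕ), j < w.length → c (s + n * w.length + j) = w.getD j 0

/-- A triple is affine if it has a characteristic sequence (it is not broken), and this sequence
is affine. -/
def BicharTriple.IsAffine {R : Type*} [CommRing R] (t : BicharTriple R) : Prop :=
  ∃ c : ℤ → ℕ, t.IsCharSeq c ∧ IsAffineSeq c

/-- The table of generalized Dynkin diagrams of affine bicharacters of rank two:
`AffineTable t w` says that `t` is one of the listed diagrams, in a row with period `w`. -/
inductive AffineTable : BicharTriple ℂ → List ℕ → Prop
  | row1 (ζ : ℂˣ) : IsPrimitiveRoot ζ 3 → AffineTable ⟨ζ, ζ, ζ⟩ [2]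
  | row2 (ζ : ℂˣ) : IsPrimitiveRoot ζ 6 → AffineTable ⟨ζ ^ 2, ζ ^ 5, ζ ^ 2⟩ [2]
  | row3 (ζ : ℂˣ) : IsPrimitiveRoot ζ 6 → AffineTable ⟨ζ, ζ ^ 4, ζ ^ 4⟩ [2]
  | row4a (ζ : ℂˣ) : IsPrimitiveRoot ζ 6 → AffineTable ⟨ζ ^ 4, ζ, ζ ^ 2⟩ [2]
  | row4b (ζ : ℂˣ) : IsPrimitiveRoot ζ 6 → AffineTable ⟨ζ ^ 2, ζ ^ 3, ζ ^ 2⟩ [2]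
  | row4c (ζ : ℂˣ) : IsPrimitiveRoot ζ 6 → AffineTable ⟨ζ ^ 2, ζ, ζ ^ 4⟩ [2]
  | row5 (ζ : ℂˣ) : IsPrimitiveRoot ζ 12 → AffineTable ⟨ζ, ζ ^ 10, ζ ^ 4⟩ [2]
  | row6 (ζ : ℂˣ) : IsPrimitiveRoot ζ 5 → AffineTable ⟨ζ, ζ ^ 4, ζ ^ 4⟩ [1, 4]
  | row7 (ζ : ℂˣ) : IsPrimitiveRoot ζ 8 → AffineTable ⟨ζ ^ 4, ζ ^ 4, ζ⟩ [1, 4]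
  | row8 (ζ : ℂˣ) : IsPrimitiveRoot ζ 10 → AffineTable ⟨ζ, ζ ^ 9, ζ ^ 4⟩ [1, 4]
  | row9a (ζ : ℂˣ) : IsPrimitiveRoot ζ 12 → AffineTable ⟨ζ, ζ ^ 10, ζ ^ 9⟩ [2, 3, 1, 3]
  | row9b (ζ : ℂˣ) : IsPrimitiveRoot ζ 12 → AffineTable ⟨ζ ^ 9, ζ ^ 8, ζ ^ 4⟩ [2, 3, 1, 3]
  | row10a (ζ : ℂˣ) : IsPrimitiveRoot ζ 12 → AffineTable ⟨ζ, ζ ^ 8, ζ ^ 6⟩ [4, 1, 3, 3, 1]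
  | row10b (ζ : ℂˣ) : IsPrimitiveRoot ζ 12 → AffineTable ⟨ζ ^ 6, ζ ^ 4, ζ ^ 3⟩ [4, 1, 3, 3, 1]
  | row10c (ζ : ℂˣ) : IsPrimitiveRoot ζ 12 → AffineTable ⟨ζ ^ 3, ζ ^ 2, ζ ^ 9⟩ [4, 1, 3, 3, 1]
  | row10d (ζ : ℂˣ) : IsPrimitiveRoot ζ 12 → AffineTable ⟨ζ ^ 9, ζ ^ 4, ζ ^ 6⟩ [4, 1, 3, 3, 1]
  | row10e (ζ : ℂˣ) : IsPrimitiveRoot ζ 12 → AffineTable ⟨ζ ^ 6, ζ ^ 8, ζ ^ 7⟩ [4, 1, 3, 3, 1]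
  | row11a (ζ : ℂˣ) : IsPrimitiveRoot ζ 18 → AffineTable ⟨ζ, ζ ^ 12, ζ ^ 9⟩ [6, 1, 3, 1]
  | row11b (ζ : ℂˣ) : IsPrimitiveRoot ζ 18 → AffineTable ⟨ζ ^ 9, ζ ^ 6, ζ ^ 4⟩ [6, 1, 3, 1]
  | row12 (q : ℂˣ) : q ≠ 1 → q ≠ -1 → AffineTable ⟨q, (q ^ 2)⁻¹, q⟩ [2]
  | row13 (q : ℂˣ) : q ≠ 1 → q ≠ -1 → AffineTable ⟨q, (q ^ 2)⁻¹, -q⟩ [2]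
  | row14 (q : ℂˣ) : q ≠ 1 → q ≠ -1 → ¬ IsPrimitiveRoot q 3 → ¬ IsPrimitiveRoot q 4 →
      AffineTable ⟨q, (q ^ 4)⁻¹, q ^ 4⟩ [1, 4]

/-!
An affine sequence comes from a triangulated strip: the polygons of the quiddity cycles, coded here
as binary trees, each cut off by an edge (`IsQuiddity.exists_edgeTree`), are joined by triangles with
a common vertex at infinity. Two consequences are used. First, labelling the neighbours of infinity
by one extends to a positive solution of `h (i - 1) + h (i + 1) = c i * h i`, so that no recursion
with a window of the sequence as coefficients and starting with `0`, `1` returns to a nonpositive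
value (`IsTreeSeq.staysPositive`, `refutes_eq_false`). Secondly, the sequence or its reverse contains
one of the `22` words `keyWords` (`IsTreeSeq.exists_keyWord`): a tree of height at least three
contains one of height exactly three, whose word is explicit, and if all trees have height at most
two, then finitely many beginnings of a strip have to be looked at.

Exchanging the labels after every reflection turns the characteristic sequence into the record of one
map `Step`, iterated in both directions, without distinction of parities (`isCharSeq_iff`). Since the
inverse of this map is conjugate to it by the exchange of the labels, a sequence may be shifted and
reversed.

Now let a key word occur at some position. Each of its letters gives a monomial relation for the
triple there: `q₁ ^ m * q = 1`, or `q₁ ^ (m + 1) = 1`. If both of the first two relations are of the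
first kind, then the reflections fix the triple up to the exchange of the labels, the sequence
alternates between two values, and the triple is in one of the rows with a free parameter
(`inTable_of_two_relations`). Otherwise three of the relations are independent. By Cramer's rule the
entries of the triple are then roots of unity of order dividing the determinant
(`pow_natAbs_det`), and there are finitely many possibilities. For each of them the sequence is
computed in terms of exponents: either the triple is in the table, or the sequence breaks off,
deviates from the word, or violates the positivity above (`checkWord_of_mem`,
`IsChain.inTable_of_checkWord`).

Finally, the reflections of a triple in the table run through a finite orbit in the table, along
which the stated period can be read off (`hasTableOrbit`). Together with the uniqueness of the
characteristic sequence (`IsChain.unique`) this carries membership in the table from the position of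
the key word to the given triple, and gives the period. Conversely, sequences with these periods are
glued from quiddity cycles with two, three and five entries (`AffineTable.isAffineSeq`).
-/

/-! ### Triangulated polygons with a marked edge -/

/-- A triangulation of a convex polygon with a marked edge: either the degenerate polygon with two
vertices, or the triangle at the marked edge with a triangulated polygon glued to each of its two
other edges. The vertices are numbered from one end of the marked edge to the other. -/
inductive EdgeTree
  | leaf : EdgeTree
  | node (l r : EdgeTree) : EdgeTree

namespace EdgeTree

/-- The number of triangles at the first vertex. -/
def first : EdgeTree → ℕ
  | leaf => 0
  | node l _ => first l + 1

/-- The number of triangles at the last vertex. -/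
def last : EdgeTree → ℕ
  | leaf => 0
  | node _ r => last r + 1

/-- The numbers of triangles at the vertices not on the marked edge. -/
def inner : EdgeTree → List ℕ
  | leaf => []
  | node l r => inner l ++ (last l + 1 + first r) :: inner r

/-- The reflected triangulation. -/
def mirror : EdgeTree → EdgeTree
  | leaf => leaf
  | node l r => node (mirror r) (mirror l)

/-- The union of two triangulated polygons along their marked edges, the marked edge of the union
being the first edge of the first polygon. -/
def turn : EdgeTree → EdgeTree → EdgeTree
  | leaf, s => s
  | node l r, s => turn l (node r s)

/-- The height of the tree. -/
def height : EdgeTree → ℕ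
  | leaf => 0
  | node l r => max (height l) (height r) + 1

/-- The numbers of triangles at all vertices. -/
def quiddity (t : EdgeTree) : List ℕ := t.first :: t.inner ++ [t.last]

lemma first_mirror (t : EdgeTree) : t.mirror.first = t.last := by
  induction t with
  | leaf => rfl
  | node l r _ ihr => simp [mirror, first, last, ihr]

lemma last_mirror (t : EdgeTree) : t.mirror.last = t.first := by
  induction t with
  | leaf => rfl
  | node l r ihl _ => simp [mirror, first, last, ihl]

lemma inner_mirror (t : EdgeTree) : t.mirror.inner = t.inner.reverse := by
  induction t with
  | leaf => rfl
  | node l r ihl ihr =>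
    simp only [mirror, inner, ihl, ihr, first_mirror, last_mirror, List.reverse_append,
      List.reverse_cons, List.append_assoc, List.singleton_append]
    congr 2; omega

lemma quiddity_mirror (t : EdgeTree) : t.mirror.quiddity = t.quiddity.reverse := by
  simp [quiddity, first_mirror, last_mirror, inner_mirror]

lemma quiddity_turn (l s : EdgeTree) :
    (turn l s).quiddity = l.inner ++ (l.last + s.first) :: s.inner ++ [s.last + l.first] := by
  induction l generalizing s with
  | leaf => simp [turn, quiddity, inner, first, last]
  | node l r ihl _ =>
    rw [turn, ihl]
    simp only [inner, first, last, List.append_assoc, List.cons_append]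
    rw [add_assoc l.last, add_comm 1 r.first, add_right_comm s.last, add_assoc s.last]

lemma exists_quiddity_rotate {a : ℕ} {l : List ℕ} {t : EdgeTree} (h : a :: l = t.quiddity) :
    ∃ s : EdgeTree, l ++ [a] = s.quiddity := by
  refine ⟨turn t leaf, ?_⟩
  rw [quiddity, List.cons_append, List.cons.injEq] at h
  rw [quiddity_turn, h.1, h.2]
  simp [first, last, inner]

end EdgeTree

/-- Every quiddity cycle comes from a triangulated polygon, whichever edge is marked. -/
theorem IsQuiddity.exists_edgeTree {l : List ℕ} (h : IsQuiddity l) :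
    ∃ t : EdgeTree, l = t.quiddity := by
  induction h with
  | base => exact ⟨.leaf, rfl⟩
  | rotate a l _ ih =>
    obtain ⟨t, ht⟩ := ih
    exact EdgeTree.exists_quiddity_rotate ht
  | reverse l _ ih =>
    obtain ⟨t, ht⟩ := ih
    exact ⟨t.mirror, by rw [EdgeTree.quiddity_mirror, ht]⟩
  | ear a b l _ ih =>
    obtain ⟨t, ht⟩ := ih
    obtain ⟨s, hs⟩ := EdgeTree.exists_quiddity_rotate ht
    -- glue the ear to the marked edge, then rotate back; the backward rotation is a forward
    -- rotation of the mirror image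
    have h1 : (b + 1) :: (l ++ [a + 1, 1]) = (EdgeTree.node s .leaf).quiddity := by
      have e : b :: l = s.first :: s.inner ∧ a = s.last := by
        have := List.append_inj' (s₁ := b :: l) (t₁ := [a]) hs rfl
        simpa using this
      simp only [List.cons.injEq] at e
      obtain ⟨⟨rfl, rfl⟩, rfl⟩ := e
      simp [EdgeTree.quiddity, EdgeTree.first, EdgeTree.last, EdgeTree.inner]
    have h2 : 1 :: ((a + 1) :: (l.reverse ++ [b + 1])) =
        (EdgeTree.node s .leaf).mirror.quiddity := by
      rw [EdgeTree.quiddity_mirror, ← h1]; simp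
    obtain ⟨s1, hs1⟩ := EdgeTree.exists_quiddity_rotate h2
    obtain ⟨s2, hs2⟩ := EdgeTree.exists_quiddity_rotate hs1
    refine ⟨s2.mirror, ?_⟩
    rw [EdgeTree.quiddity_mirror, ← hs2]; simp

/-! ### Windows of bi-infinite sequences -/

/-- The entries `c i, c (i + 1), …, c (i + n - 1)`. -/
def window {α : Type*} (c : ℤ → α) : ℤ → ℕ → List α
  | _, 0 => []
  | i, n + 1 => c i :: window c (i + 1) n

/-- The word `w` stands in the sequence `c` from position `i` on. -/
def Occurs {α : Type*} (c : ℤ → α) (i : ℤ) (w : List α) : Prop := window c i w.length = w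

section Window

variable {α : Type*} {c : ℤ → α}

@[simp] lemma length_window (i : ℤ) (n : ℕ) : (window c i n).length = n := by
  induction n generalizing i with
  | zero => rfl
  | succ n ih => simp [window, ih]

lemma occurs_window (i : ℤ) (n : ℕ) : Occurs c i (window c i n) := by
  simp [Occurs]

@[simp] lemma occurs_nil (i : ℤ) : Occurs c i [] := rfl

@[simp] lemma occurs_cons {i : ℤ} {a : α} {w : List α} :
    Occurs c i (a :: w) ↔ c i = a ∧ Occurs c (i + 1) w := by
  simp [Occurs, window]

lemma occurs_append {i : ℤ} {u v : List α} :
    Occurs c i (u ++ v) ↔ Occurs c i u ∧ Occurs c (i + u.length) v := by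
  induction u generalizing i with
  | nil => simp
  | cons a u ih =>
    simp only [List.cons_append, occurs_cons, ih, List.length_cons, and_assoc]
    push_cast
    rw [show i + 1 + (u.length : ℤ) = i + (u.length + 1) by ring]

lemma Occurs.infix {i : ℤ} {w l : List α} (h : Occurs c i l) (hw : w <:+: l) :
    ∃ j, Occurs c j w := by
  obtain ⟨u, v, rfl⟩ := hw
  exact ⟨_, (occurs_append.1 (occurs_append.1 h).1).2⟩

lemma Occurs.comp_neg_reverse {i : ℤ} {w : List α} (h : Occurs c i w) :
    Occurs (fun j => c (-j)) (1 - i - w.length) w.reverse := by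
  induction w generalizing i with
  | nil => simp
  | cons a w ih =>
    rw [occurs_cons] at h
    rw [List.reverse_cons, occurs_append]
    refine ⟨?_, ?_⟩
    · convert ih h.2 using 1
      simp; ring
    · simp only [occurs_cons, occurs_nil, and_true, List.length_reverse, List.length_cons, ← h.1]
      congr 1; push_cast; ring

lemma occurs_of_getD {i : ℤ} {w : List α} (d : α)
    (h : ∀ j : ℕ, j < w.length → c (i + j) = w.getD j d) : Occurs c i w := by
  induction w generalizing i with
  | nil => simp
  | cons a w ih =>
    refine occurs_cons.2 ⟨by simpa using h 0 (by simp), ih fun j hj => ?_⟩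
    have := h (j + 1) (by simpa using hj)
    simp only [List.getD_cons_succ] at this
    rw [← this]; push_cast; ring_nf

lemma Occurs.prefix_window {i : ℤ} {w : List α} (h : Occurs c i w) {n : ℕ} (hn : w.length ≤ n) :
    w <+: window c i n := by
  obtain ⟨k, rfl⟩ := Nat.exists_eq_add_of_le hn
  have := occurs_window (c := c) i (w.length + k)
  refine ⟨window c (i + w.length) k, ?_⟩
  rw [show window c i (w.length + k) = window c i w.length ++ window c (i + w.length) k from ?_, h]
  clear h this
  generalize w.length = m
  induction m generalizing i with
  | zero => simp [window]
  | succ m ih =>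
    rw [show m + 1 + k = (m + k) + 1 by ring]
    simp only [window, ih, List.cons_append]
    push_cast
    rw [show i + 1 + (m : ℤ) = i + (m + 1) by ring]

end Window

/-! ### Affine sequences and their positivity -/

/-- The description of an affine sequence by triangulated polygons: `t k` has its marked edge
between the positions `p k` and `p (k + 1)`. -/
def IsTreeSeq (c : ℤ → ℕ) (t : ℤ → EdgeTree) (p : ℤ → ℤ) : Prop :=
  ∀ k : ℤ, p (k + 1) = p k + (t k).inner.length + 1 ∧
    c (p k) = (t (k - 1)).last + 2 + (t k).first ∧ Occurs c (p k + 1) (t k).inner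

theorem IsAffineSeq.exists_isTreeSeq {c : ℤ → ℕ} (h : IsAffineSeq c) :
    ∃ t p, IsTreeSeq c t p := by
  obtain ⟨C, p, h⟩ := h
  choose t ht using fun k => (h k).1.exists_edgeTree
  refine ⟨t, p, fun k => ?_⟩
  obtain ⟨_, _, h1, h2, h3⟩ := h k
  rw [ht k] at h1 h3
  rw [ht k, ht (k - 1)] at h2
  refine ⟨?_, ?_, occurs_of_getD 0 fun j hj => ?_⟩
  · rw [h1]; simp [EdgeTree.quiddity]; ring
  · rw [h2]; simp [EdgeTree.quiddity, List.getLastD_eq_getLast?, List.getLast?_cons]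
  · have := h3 (j + 1) (by omega) (by simp [EdgeTree.quiddity]; omega)
    rw [add_assoc, add_comm (1 : ℤ), ← Nat.cast_succ, Nat.succ_eq_add_one, this]
    simp only [EdgeTree.quiddity, List.cons_append, List.getD_cons_succ]
    rw [List.getD_append _ _ _ _ hj]

theorem IsTreeSeq.comp_neg {c : ℤ → ℕ} {t : ℤ → EdgeTree} {p : ℤ → ℤ} (h : IsTreeSeq c t p) :
    IsTreeSeq (fun i => c (-i)) (fun k => (t (-k)).mirror) (fun k => -p (1 - k)) := by
  intro k
  have h1 := (h (-k)).1
  have h2 := (h (1 - k)).2.1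
  have h3 := (h (-k)).2.2.comp_neg_reverse
  rw [show -k + 1 = 1 - k by ring] at h1
  rw [show 1 - k - 1 = -k by ring] at h2
  refine ⟨?_, ?_, ?_⟩
  · simp only [EdgeTree.inner_mirror, List.length_reverse]
    rw [show 1 - (k + 1) = -k by ring, h1]; ring
  · simp only [EdgeTree.first_mirror, EdgeTree.last_mirror, neg_neg, h2]
    rw [show -(k - 1) = 1 - k by ring]; ring
  · rw [EdgeTree.inner_mirror]
    convert h3 using 1
    simp only [h1]; ring

/-- The two values `u`, `v`, continued by the recursion whose coefficients are the entries of the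
word, stay positive. -/
def StaysPositive (u v : ℤ) : List ℕ → Prop
  | [] => 0 < u ∧ 0 < v
  | c :: w => 0 < u ∧ 0 < v ∧ StaysPositive v (c * v - u) w

lemma StaysPositive.of_append {u v : ℤ} {w w' : List ℕ} (h : StaysPositive u v (w ++ w')) :
    StaysPositive u v w ∧ ∃ u' v', StaysPositive u' v' w' := by
  induction w generalizing u v with
  | nil =>
    refine ⟨?_, u, v, h⟩
    cases w' with
    | nil => exact h
    | cons a w' => exact ⟨h.1, h.2.1⟩
  | cons a w ih =>
    obtain ⟨h1, h2, h3⟩ := h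
    exact ⟨⟨h1, h2, (ih h3).1⟩, (ih h3).2⟩

lemma StaysPositive.infix {u v : ℤ} {w l : List ℕ} (h : StaysPositive u v l) (hw : w <:+: l) :
    ∃ u' v', StaysPositive u' v' w := by
  obtain ⟨a, b, rfl⟩ := hw
  exact h.of_append.1.of_append.2

/-- Labels `x` and `y` at the ends of the marked edge extend to the whole polygon: each triangle
gives its third vertex the sum of the labels of the other two. -/
lemma EdgeTree.staysPositive_inner (t : EdgeTree) {x y : ℤ} (hx : 0 < x) (hy : 0 < y)
    {w : List ℕ} (h : StaysPositive (t.last * y + x) y w) :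
    StaysPositive x (t.first * x + y) (t.inner ++ w) := by
  induction t generalizing x y w with
  | leaf => simpa [first, last, inner] using h
  | node l r ihl ihr =>
    simp only [inner, List.append_assoc, List.cons_append]
    have h1 : StaysPositive (x + y) (r.first * (x + y) + y) (r.inner ++ w) := by
      refine ihr (by positivity) hy ?_
      convert h using 1
      simp only [last]; push_cast; ring
    have := ihl (y := x + y) hx (by positivity)
      (w := (l.last + 1 + r.first) :: (r.inner ++ w)) ⟨by positivity, by positivity, ?_⟩
    · convert this using 1
      simp only [first]; push_cast; ring
    · convert h1 using 1
      push_cast; ring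

/-- An affine sequence is the sequence of coefficients of a recursion with a positive solution, so
this is true of each of its windows. In the strip with vertices at the positions `p k` and at
infinity, all the `p k` get the label one. -/
theorem IsTreeSeq.staysPositive {c : ℤ → ℕ} {t : ℤ → EdgeTree} {p : ℤ → ℤ} (h : IsTreeSeq c t p)
    (i : ℤ) {w : List ℕ} (hw : Occurs c i w) : ∃ u v, StaysPositive u v w := by
  have key : ∀ (n : ℕ) (k : ℤ), ∃ l : List ℕ, n ≤ l.length ∧ Occurs c (p k) l ∧
      StaysPositive ((t (k - 1)).last + 1) 1 l := by
    intro n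
    induction n with
    | zero => exact fun k => ⟨[], le_rfl, rfl, by positivity, one_pos⟩
    | succ n ih =>
      intro k
      obtain ⟨l, h1, h2, h3⟩ := ih (k + 1)
      obtain ⟨e1, e2, e3⟩ := h k
      refine ⟨((t (k - 1)).last + 2 + (t k).first) :: ((t k).inner ++ l), ?_, ?_, by positivity,
        one_pos, ?_⟩
      · simp; omega
      · rw [occurs_cons, occurs_append]
        refine ⟨e2, e3, ?_⟩
        rwa [show p k + 1 + ((t k).inner.length : ℤ) = p (k + 1) by rw [e1]; ring]
      · rw [add_sub_cancel_right] at h3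
        convert (t k).staysPositive_inner one_pos one_pos (w := l) (by simpa using h3) using 1
        push_cast; ring
  have hp : ∀ n : ℕ, p (-n) ≤ p 0 - n := by
    intro n
    induction n with
    | zero => simp
    | succ n ih =>
      have := (h (-(n + 1 : ℕ))).1
      rw [show -((n + 1 : ℕ) : ℤ) + 1 = -n by push_cast; ring] at this
      push_cast at this ⊢
      omega
  obtain ⟨d, hd⟩ : ∃ d : ℕ, i = p (-(p 0 - i).toNat) + d := by
    refine ⟨(i - p (-(p 0 - i).toNat)).toNat, ?_⟩
    have := hp (p 0 - i).toNat
    omega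
  obtain ⟨l, h1, h2, h3⟩ := key (d + w.length) (-(p 0 - i).toNat)
  refine h3.infix ?_
  have h4 : Occurs c (p (-(p 0 - i).toNat)) (window c (p (-(p 0 - i).toNat)) d ++ w) := by
    rw [occurs_append, length_window, ← hd]
    exact ⟨occurs_window _ _, hw⟩
  have h5 := h4.prefix_window (n := l.length) (by simpa using h1)
  rw [h2] at h5
  exact (List.suffix_append _ _).isInfix.trans h5.isInfix

/-! ### Words that occur in every affine sequence -/

/-- Every affine sequence contains one of these words or the reverse of one. -/
def keyWords : List (List ℕ) :=
  [[1, 2, 2], [1, 2, 3], [1, 2, 4, 1], [1, 2, 4, 2, 1, 4], [1, 2, 4, 2, 1, 5], [1, 2, 4, 2, 1, 6],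
   [1, 2, 5, 1], [2, 1, 3], [2, 1, 4], [2, 1, 5], [1, 3, 1, 3], [1, 3, 1, 4], [1, 3, 1, 5],
   [1, 3, 1, 6, 1], [1, 3, 2, 2], [1, 3, 2, 3, 1, 3], [1, 3, 2, 3, 1, 4], [1, 3, 3, 1, 3],
   [1, 3, 3, 1, 4], [1, 4, 1, 3], [1, 4, 1, 4, 1], [2, 2, 2, 2, 2, 2]]

/-- Some key word or its reverse is a block of the list. -/
def HasKeyWord (l : List ℕ) : Prop := ∃ w ∈ keyWords, w <:+: l ∨ w.reverse <:+: l

instance (l : List ℕ) : Decidable (HasKeyWord l) :=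
  inferInstanceAs (Decidable (∃ w ∈ keyWords, w <:+: l ∨ w.reverse <:+: l))

lemma HasKeyWord.mono {l l' : List ℕ} (h : HasKeyWord l) (hl : l <:+: l') : HasKeyWord l' := by
  obtain ⟨w, hw, h | h⟩ := h
  · exact ⟨w, hw, .inl (h.trans hl)⟩
  · exact ⟨w, hw, .inr (h.trans hl)⟩

namespace EdgeTree

/-- The trees of height at most two. -/
def lowTrees : List EdgeTree :=
  [leaf, node leaf leaf, node (node leaf leaf) leaf, node leaf (node leaf leaf),
    node (node leaf leaf) (node leaf leaf)]

lemma eq_leaf_of_height_le_zero {t : EdgeTree} (h : t.height ≤ 0) : t = leaf := by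
  cases t with
  | leaf => rfl
  | node l r => simp [height] at h

lemma eq_of_height_le_one {t : EdgeTree} (h : t.height ≤ 1) : t = leaf ∨ t = node leaf leaf := by
  cases t with
  | leaf => exact .inl rfl
  | node l r =>
    rw [height, Nat.add_le_add_iff_right, max_le_iff] at h
    rw [eq_leaf_of_height_le_zero h.1, eq_leaf_of_height_le_zero h.2]
    exact .inr rfl

lemma mem_lowTrees {t : EdgeTree} (h : t.height ≤ 2) : t ∈ lowTrees := by
  cases t with
  | leaf => simp [lowTrees]
  | node l r =>
    rw [height, Nat.add_le_add_iff_right (n := 1), max_le_iff] at h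
    obtain rfl | rfl := eq_of_height_le_one h.1 <;>
      obtain rfl | rfl := eq_of_height_le_one h.2 <;> simp [lowTrees]

/-- A tree of height at least three contains a tree of height exactly three, and of these there are
finitely many. -/
lemma hasKeyWord_inner {t : EdgeTree} (h : 3 ≤ t.height) : HasKeyWord t.inner := by
  induction t with
  | leaf => simp [height] at h
  | node l r ihl ihr =>
    by_cases hl : 3 ≤ l.height
    · exact (ihl hl).mono (List.prefix_append _ _).isInfix
    by_cases hr : 3 ≤ r.height
    · exact (ihr hr).mono ((List.suffix_cons _ _).trans (List.suffix_append _ _)).isInfix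
    have key : ∀ l ∈ lowTrees, ∀ r ∈ lowTrees, 3 ≤ (node l r).height →
        HasKeyWord (node l r).inner := by decide +kernel
    exact key l (mem_lowTrees (by omega)) r (mem_lowTrees (by omega)) h

/-- The part of an affine sequence coming from consecutive polygons of a strip. -/
def stripWord : List EdgeTree → List ℕ
  | [] => []
  | [t] => t.inner
  | t :: s :: ts => t.inner ++ (t.last + 2 + s.first) :: stripWord (s :: ts)

/-- Search for a key word: the word of the given strip contains one, or those of all its extensions
by one low tree do so, and so on up to the given depth. -/
def forcesKeyWord : ℕ → List EdgeTree → Bool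
  | 0, ts => decide (HasKeyWord (stripWord ts))
  | n + 1, ts => decide (HasKeyWord (stripWord ts)) ||
      lowTrees.all fun t => forcesKeyWord n (ts ++ [t])

end EdgeTree

lemma IsTreeSeq.occurs_stripWord {c : ℤ → ℕ} {t : ℤ → EdgeTree} {p : ℤ → ℤ}
    (h : IsTreeSeq c t p) {k : ℤ} {ts : List EdgeTree} (hts : Occurs t k ts) :
    Occurs c (p k + 1) (EdgeTree.stripWord ts) := by
  induction ts generalizing k with
  | nil => simp [EdgeTree.stripWord]
  | cons a ts ih =>
    obtain ⟨rfl, hts'⟩ := occurs_cons.1 hts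
    cases ts with
    | nil => exact (h k).2.2
    | cons b ts =>
      obtain ⟨rfl, -⟩ := occurs_cons.1 hts'
      have h1 := (h k).1
      have h2 := (h (k + 1)).2.1
      rw [add_sub_cancel_right] at h2
      refine occurs_append.2 ⟨(h k).2.2, ?_⟩
      rw [show p k + 1 + ((t k).inner.length : ℤ) = p (k + 1) by rw [h1]; ring]
      exact occurs_cons.2 ⟨h2, ih hts'⟩

lemma IsTreeSeq.exists_hasKeyWord_of_forces {c : ℤ → ℕ} {t : ℤ → EdgeTree} {p : ℤ → ℤ}
    (h : IsTreeSeq c t p) (hlow : ∀ k, t k ∈ EdgeTree.lowTrees) {n : ℕ} {k : ℤ}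
    {ts : List EdgeTree} (hts : Occurs t k ts) (hn : EdgeTree.forcesKeyWord n ts) :
    ∃ i l, Occurs c i l ∧ HasKeyWord l := by
  induction n generalizing ts with
  | zero => exact ⟨_, _, h.occurs_stripWord hts, of_decide_eq_true hn⟩
  | succ n ih =>
    rw [EdgeTree.forcesKeyWord, Bool.or_eq_true, decide_eq_true_eq, List.all_eq_true] at hn
    obtain hn | hn := hn
    · exact ⟨_, _, h.occurs_stripWord hts, hn⟩
    · exact ih (occurs_append.2 ⟨hts, by simp⟩) (hn _ (hlow (k + ts.length)))

theorem IsTreeSeq.exists_keyWord {c : ℤ → ℕ} {t : ℤ → EdgeTree} {p : ℤ → ℤ}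
    (h : IsTreeSeq c t p) :
    ∃ w ∈ keyWords, ∃ i, Occurs c i w ∨ Occurs (fun j => c (-j)) i w := by
  obtain ⟨i, l, hl, w, hw, hwl⟩ : ∃ i l, Occurs c i l ∧ HasKeyWord l := by
    by_cases hlow : ∀ k, (t k).height ≤ 2
    · exact h.exists_hasKeyWord_of_forces (fun k => EdgeTree.mem_lowTrees (hlow k))
        (n := 7) (k := 0) (occurs_nil 0) (by decide +kernel)
    · push Not at hlow
      obtain ⟨k, hk⟩ := hlow
      exact ⟨_, _, (h k).2.2, EdgeTree.hasKeyWord_inner hk⟩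
  obtain hwl | hwl := hwl
  · obtain ⟨j, hj⟩ := hl.infix hwl
    exact ⟨w, hw, j, .inl hj⟩
  · obtain ⟨j, hj⟩ := hl.infix hwl
    have := hj.comp_neg_reverse
    rw [List.reverse_reverse] at this
    exact ⟨w, hw, _, .inr this⟩

/-! ### The integers `m` and the reflections -/

namespace BicharTriple

section Field

variable {K : Type*} [Field K]

lemma sum_pow_eq_zero_iff [CharZero K] (a : Kˣ) (m : ℕ) :
    ∑ i ∈ Finset.range (m + 1), (a : K) ^ i = 0 ↔ a ≠ 1 ∧ a ^ (m + 1) = 1 := by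
  have h := mul_geom_sum (a : K) (m + 1)
  have e : a ^ (m + 1) = 1 ↔ (a : K) ^ (m + 1) - 1 = 0 := by
    rw [sub_eq_zero, Units.ext_iff]; simp
  by_cases ha : a = 1
  · simp only [ha, Units.val_one, one_pow, Finset.sum_const, Finset.card_range, nsmul_eq_mul,
      mul_one, ne_eq, not_true_eq_false, false_and, iff_false]
    exact_mod_cast m.succ_ne_zero
  · have ha' : (a : K) - 1 ≠ 0 := by
      rw [sub_ne_zero]; exact fun h => ha (Units.ext h)
    rw [e, ← h, mul_eq_zero]
    simp [ha, ha']

/-- In characteristic zero the first alternative in the definition of the integer says that `a` is a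
nontrivial root of unity of order dividing `m + 1`. -/
lemma isCartanEntry_iff [CharZero K] {a b : Kˣ} {m : ℕ} :
    IsCartanEntry a b m ↔ ((a ≠ 1 ∧ a ^ (m + 1) = 1) ∨ a ^ m * b = 1) ∧
      ∀ k < m, ¬ ((a ≠ 1 ∧ a ^ (k + 1) = 1) ∨ a ^ k * b = 1) := by
  simp only [IsCartanEntry, IsLeast, Set.mem_ofPred_eq, sum_pow_eq_zero_iff, mem_lowerBounds]
  refine and_congr_right fun _ => ⟨fun h k hk hk' => absurd (h k hk') (by omega), fun h k hk => ?_⟩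
  by_contra hlt
  exact h k (by omega) hk

lemma IsCartanEntry.unique {a b : Kˣ} {m m' : ℕ} (h : IsCartanEntry a b m)
    (h' : IsCartanEntry a b m') : m = m' :=
  IsLeast.unique h h'

lemma IsCartanEntry.ne_one [CharZero K] {a b : Kˣ} {m : ℕ} (h : IsCartanEntry a b m) (hm : m ≠ 0)
    (hab : a ^ m * b = 1) : a ≠ 1 := by
  rintro rfl
  exact (isCartanEntry_iff.1 h).2 0 (by omega) (.inr (by simpa using hab))

lemma IsCartanEntry.pow_succ_ne_one [CharZero K] {a b : Kˣ} {m k : ℕ} (h : IsCartanEntry a b m) (hk : k < m)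
    (hab : a ^ m * b = 1) : a ^ (k + 1) ≠ 1 := fun hk' =>
  (isCartanEntry_iff.1 h).2 k hk (.inl ⟨h.ne_one (by omega) hab, hk'⟩)

/-- A reflection does not change its integer: if the integer comes from the order of `a`, then
`a ^ k * b' = 1` means that `a ^ (m - 1 - k) * b = 1`. -/
lemma IsCartanEntry.reflect [CharZero K] {a b : Kˣ} {m : ℕ} (h : IsCartanEntry a b m) :
    IsCartanEntry a ((a ^ (2 * m))⁻¹ * b⁻¹) m := by
  by_cases hC : a ^ m * b = 1
  · convert h using 1
    rw [eq_comm, ← mul_right_inj (a ^ m), hC, two_mul, pow_add, mul_inv, ← mul_assoc, ← mul_assoc,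
      mul_inv_cancel, one_mul, ← mul_inv, hC, inv_one]
  · rw [isCartanEntry_iff] at h ⊢
    have hR := h.1.resolve_right hC
    refine ⟨.inl hR, fun k hk hk' => ?_⟩
    obtain hk' | hk' := hk'
    · exact h.2 k hk (.inl hk')
    · refine h.2 (m - 1 - k) (by omega) (.inr ?_)
      have e : a ^ (2 * m) = a ^ k * a ^ (m - 1 - k) := by
        rw [show 2 * m = (k + (m - 1 - k)) + (m + 1) by omega, pow_add, hR.2, mul_one, pow_add]
      rw [e, mul_inv, ← mul_assoc, ← mul_assoc, mul_inv_cancel, one_mul, ← mul_inv, inv_eq_one] at hk'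
      exact hk'

/-- The reflection `σ₁` followed by the exchange of the labels. An alternating sequence of
reflections becomes an iteration of this one map. -/
def Step (m : ℕ) (s s' : BicharTriple K) : Prop :=
  IsCartanEntry s.q₁ s.q m ∧
    s' = ⟨s.q₁ ^ (m ^ 2) * s.q ^ m * s.q₂, (s.q₁ ^ (2 * m))⁻¹ * s.q⁻¹, s.q₁⟩

@[simp] lemma swap_swap (s : BicharTriple K) : s.swap.swap = s := rfl

lemma Step.symm [CharZero K] {m : ℕ} {s s' : BicharTriple K} (h : Step m s s') : Step m s'.swap s.swap := by
  obtain ⟨h1, rfl⟩ := h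
  refine ⟨h1.reflect, ?_⟩
  have e : (s.q₁ ^ (2 * m)) ^ m = s.q₁ ^ (m ^ 2) * s.q₁ ^ (m ^ 2) := by
    rw [← pow_mul, ← pow_add]; congr 1; ring
  simp only [swap, BicharTriple.mk.injEq, and_true]
  refine ⟨?_, ?_⟩
  · rw [mul_pow, inv_pow, inv_pow, e]
    ext; push_cast; field_simp
  · ext; push_cast; field_simp

lemma Step.unique {m m' : ℕ} {s s' s'' : BicharTriple K} (h : Step m s s') (h' : Step m' s s'') :
    m = m' ∧ s' = s'' := by
  obtain rfl := h.1.unique h'.1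
  exact ⟨rfl, h.2.trans h'.2.symm⟩

/-- If the integer comes from `q₁ ^ m * q = 1`, then the reflection fixes the triple. -/
lemma Step.eq_swap {m : ℕ} {s s' : BicharTriple K} (h : Step m s s') (hC : s.q₁ ^ m * s.q = 1) :
    s' = s.swap := by
  have e : s.q = (s.q₁ ^ m)⁻¹ := eq_inv_of_mul_eq_one_right hC
  rw [h.2, swap, e]
  simp only [BicharTriple.mk.injEq, and_true]
  refine ⟨?_, ?_⟩
  · rw [inv_pow, ← pow_mul, ← sq, mul_inv_cancel, one_mul]
  · rw [two_mul, pow_add, mul_inv, inv_inv, inv_mul_cancel_right]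

/-- `S` is a bi-infinite sequence of triples with integers `c`, in which the labels have been
exchanged in every other triple. -/
def IsChain (S : ℤ → BicharTriple K) (c : ℤ → ℕ) : Prop := ∀ i, Step (c i) (S i) (S (i + 1))

theorem isCharSeq_iff [CharZero K] {t : BicharTriple K} {c : ℤ → ℕ} :
    t.IsCharSeq c ↔ ∃ S, S 0 = t ∧ IsChain S c := by
  constructor
  · rintro ⟨T, rfl, h0, h1⟩
    refine ⟨fun i => if Even i then T i else (T i).swap, by simp, fun i => ?_⟩
    obtain hi | hi := Int.even_or_odd i
    · have hi' : ¬ Even (i + 1) := by simpa [Int.even_add_one] using hi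
      simp only [hi, hi', if_true, if_false]
      obtain ⟨h2, h3⟩ := (h0 i hi).1
      exact ⟨h2, by rw [h3]; rfl⟩
    · have hi' : Even (i + 1) := by simpa [Int.even_add_one] using hi
      simp only [Int.not_even_iff_odd.2 hi, hi', if_true, if_false]
      obtain ⟨h2, h3⟩ := (h1 i hi).1
      refine ⟨h2, ?_⟩
      rw [h3]
      simp only [swap, BicharTriple.mk.injEq, and_true]
      rw [mul_comm, mul_assoc, mul_comm (T i).q₁]
  · rintro ⟨S, rfl, h⟩
    refine ⟨fun i => if Even i then S i else (S i).swap, by simp, fun i hi => ?_, fun i hi => ?_⟩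
    · have hi' : ¬ Even (i + 1) := by simpa [Int.even_add_one] using hi
      simp only [hi, hi', if_true, if_false]
      refine ⟨⟨(h i).1, by rw [(h i).2]; rfl⟩, ?_⟩
      obtain ⟨h2, h3⟩ := (h i).symm
      exact ⟨h2, by rw [← swap_swap (S i), h3]; rfl⟩
    · have hi' : Even (i + 1) := by simpa [Int.even_add_one] using hi
      simp only [Int.not_even_iff_odd.2 hi, hi', if_true, if_false]
      have key : ∀ s s' : BicharTriple K, Step (c i) s s' → Reflects₂ (c i) s.swap s' := by
        rintro s _ ⟨h2, rfl⟩
        refine ⟨h2, ?_⟩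
        simp only [swap, BicharTriple.mk.injEq, and_true]
        rw [mul_comm, mul_assoc, mul_comm (s.q₁ ^ _)]
      exact ⟨key _ _ (h i), key _ _ (h i).symm⟩

namespace IsChain

variable {S S' : ℤ → BicharTriple K} {c c' : ℤ → ℕ}

lemma comp_neg [CharZero K] (h : IsChain S c) : IsChain (fun i => (S (1 - i)).swap) (fun i => c (-i)) := by
  intro i
  have := (h (-i)).symm
  beta_reduce
  rw [show -i + 1 = 1 - i by ring] at this
  rwa [show 1 - (i + 1) = -i by ring]

lemma comp_add (h : IsChain S c) (n : ℤ) :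
    IsChain (fun i => S (i + n)) (fun i => c (i + n)) := by
  intro i
  have := h (i + n)
  rwa [show i + n + 1 = i + 1 + n by ring] at this

lemma eq_of_nonneg (h : IsChain S c) (h' : IsChain S' c') (h0 : S 0 = S' 0) (n : ℕ) :
    c n = c' n ∧ S (n + 1) = S' (n + 1) := by
  induction n with
  | zero =>
    have := h' 0
    rw [← h0] at this
    exact_mod_cast (h 0).unique this
  | succ n ih =>
    have := h' (n + 1)
    rw [← ih.2] at this
    exact_mod_cast (h (n + 1)).unique this

lemma unique [CharZero K] (h : IsChain S c) (h' : IsChain S' c') (h0 : S 0 = S' 0) :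
    c = c' ∧ S = S' := by
  have h1 := h.eq_of_nonneg h' h0
  -- the reversed sequences, shifted so that they start with the same triple
  have h2 := (h.comp_neg.comp_add 1).eq_of_nonneg (h'.comp_neg.comp_add 1) (by simp [h0])
  have h3 : ∀ n : ℕ, c (-(n + 1 : ℕ)) = c' (-(n + 1 : ℕ)) ∧ S (-(n + 1 : ℕ)) = S' (-(n + 1 : ℕ)) := by
    intro n
    obtain ⟨h3, h4⟩ := h2 n
    rw [show 1 - ((n : ℤ) + 1 + 1) = -(n + 1 : ℕ) by push_cast; ring] at h4
    exact ⟨by exact_mod_cast h3, congrArg swap h4⟩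
  refine ⟨funext fun i => ?_, funext fun i => ?_⟩
  · obtain ⟨_ | n, rfl | rfl⟩ := i.eq_nat_or_neg
    · exact (h1 0).1
    · exact (h1 0).1
    · exact (h1 (n + 1)).1
    · exact (h3 n).1
  · obtain ⟨_ | n, rfl | rfl⟩ := i.eq_nat_or_neg
    · exact h0
    · exact h0
    · exact_mod_cast (h1 n).2
    · exact (h3 n).2

/-- If the integers at two neighbouring positions both come from a relation `q₁ ^ m * q = 1`, then
the same two reflections are repeated forever. -/
lemma alternate (h : IsChain S c) {i : ℤ} (h0 : (S i).q₁ ^ c i * (S i).q = 1)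
    (h1 : (S (i + 1)).q₁ ^ c (i + 1) * (S (i + 1)).q = 1) :
    c (i + 2) = c i ∧ (S (i + 2)).q₁ ^ c (i + 2) * (S (i + 2)).q = 1 := by
  have e : S (i + 2) = S i := by
    have e1 := (h (i + 1)).eq_swap h1
    rw [add_assoc, one_add_one_eq_two, (h i).eq_swap h0, swap_swap] at e1
    exact e1
  have := h (i + 2)
  rw [e] at this ⊢
  obtain hc := (this.unique (h i)).1
  exact ⟨hc, by rw [hc, h0]⟩

end IsChain

end Field

end BicharTriple

/-! ### Triples of roots of unity -/

namespace BicharTriple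

/-- The triple of powers of `ζ` with the given exponents. -/
def ofExp (ζ : ℂˣ) (e : ℕ × ℕ × ℕ) : BicharTriple ℂ := ⟨ζ ^ e.1, ζ ^ e.2.1, ζ ^ e.2.2⟩

/-- Evaluation of `f` at `n`. The match makes the kernel compute `n` before it unfolds `f`, which
keeps the terms in long computations small. -/
def force {α : Type*} (n : ℕ) (f : ℕ → α) : α :=
  match n with
  | 0 => f 0
  | n + 1 => f (n + 1)

lemma force_eq {α : Type*} (n : ℕ) (f : ℕ → α) : force n f = f n := by
  cases n <;> rfl

/-- The least number from `m` on, and less than `m + n`, that satisfies `p`. -/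
def search (p : ℕ → Bool) : ℕ → ℕ → Option ℕ
  | 0, _ => none
  | n + 1, m => if p m then some m else force (m + 1) (search p n)

lemma search_eq_some_iff {p : ℕ → Bool} {n m k : ℕ} :
    search p n m = some k ↔ p k ∧ (m ≤ k ∧ k < m + n) ∧ ∀ j, m ≤ j → j < k → p j = false := by
  induction n generalizing m with
  | zero =>
    simp only [search, reduceCtorEq, false_iff]
    rintro ⟨-, h, -⟩
    omega
  | succ n ih =>
    rw [search, force_eq]
    split_ifs with hp
    · rw [Option.some.injEq]
      constructor
      · rintro rfl
        exact ⟨hp, by omega, fun j h1 h2 => by omega⟩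
      · rintro ⟨-, ⟨h1, -⟩, h2⟩
        by_contra hne
        have := h2 m le_rfl (by omega)
        simp [hp] at this
    · rw [ih]
      refine and_congr_right fun hk => ⟨fun ⟨h1, h2⟩ => ⟨by omega, fun j h3 h4 => ?_⟩,
        fun ⟨h1, h2⟩ => ⟨⟨?_, by omega⟩, fun j h3 h4 => h2 j (by omega) h4⟩⟩
      · obtain rfl | h5 := h3.eq_or_lt
        · simpa using hp
        · exact h2 j h5 h4
      · by_contra hlt
        obtain rfl : k = m := by omega
        exact hp hk

/-- The integer of `ζ ^ a` and `ζ ^ b`, for `ζ` a primitive `N`-th root of unity. -/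
def cartan (N a b : ℕ) : Option ℕ :=
  search (fun m => (a % N != 0 && a * (m + 1) % N == 0) || (a * m + b) % N == 0) N 0

/-- The integer and the exponents of the next triple, for powers of a primitive `N`-th root of
unity. -/
def stepExp (N : ℕ) (e : ℕ × ℕ × ℕ) : Option (ℕ × (ℕ × ℕ × ℕ)) :=
  (cartan N e.1 e.2.1).map fun m =>
    force ((m ^ 2 * e.1 + m * e.2.1 + e.2.2) % N) fun x =>
      force ((N - 1) * (2 * m * e.1 + e.2.1) % N) fun b => (m, (x, b, e.1))

section PrimitiveRoot

variable {ζ : ℂˣ} {N : ℕ}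

lemma pow_eq_one_iff_mod (hζ : IsPrimitiveRoot ζ N) (a : ℕ) : ζ ^ a = 1 ↔ a % N = 0 := by
  rw [hζ.pow_eq_one_iff_dvd, Nat.dvd_iff_mod_eq_zero]

lemma pow_mod_eq (hζ : IsPrimitiveRoot ζ N) (a : ℕ) : ζ ^ (a % N) = ζ ^ a := by
  conv_rhs => rw [← Nat.mod_add_div a N, pow_add, pow_mul, hζ.pow_eq_one, one_pow, mul_one]

lemma pow_pred_mul_eq (hζ : IsPrimitiveRoot ζ N) (hN : N ≠ 0) (a : ℕ) :
    ζ ^ ((N - 1) * a) = (ζ ^ a)⁻¹ := by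
  rw [eq_inv_iff_mul_eq_one, ← pow_add, pow_eq_one_iff_mod hζ, ← Nat.succ_mul,
    Nat.succ_eq_add_one, Nat.sub_add_cancel (by omega), Nat.mul_mod_right]

/-- Both alternatives in the definition of the integer have period `N`, so it is less than `N`. -/
lemma cartan_eq_some_iff (hζ : IsPrimitiveRoot ζ N) (hN : N ≠ 0) {a b m : ℕ} :
    cartan N a b = some m ↔ IsCartanEntry (ζ ^ a) (ζ ^ b) m := by
  rw [cartan, search_eq_some_iff, isCartanEntry_iff]
  simp only [← pow_mul, ← pow_add, ne_eq, pow_eq_one_iff_mod hζ, Bool.or_eq_true,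
    Bool.and_eq_true, bne_iff_ne, beq_iff_eq, zero_le, true_and, zero_add,
    true_implies, Bool.or_eq_false_iff]
  constructor
  · rintro ⟨h1, -, h3⟩
    refine ⟨h1, fun k hk => ?_⟩
    have := h3 k hk
    simp only [Bool.and_eq_false_iff, bne_eq_false_iff_eq, beq_eq_false_iff_ne] at this
    tauto
  · rintro ⟨h1, h3⟩
    refine ⟨h1, ?_, fun k hk => ?_⟩
    · by_contra hm
      obtain ⟨h1, -⟩ | h1 := h1
      · refine h3 (N - 1) (by omega) (.inl ⟨h1, ?_⟩)
        rw [Nat.sub_add_cancel (by omega), Nat.mul_mod_left]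
      · refine h3 (m - N) (by omega) (.inr ?_)
        obtain ⟨k, rfl⟩ := Nat.exists_eq_add_of_le (not_lt.1 hm)
        rw [Nat.add_sub_cancel_left]
        rwa [mul_add, add_assoc, Nat.add_mod, Nat.mul_mod_left, zero_add, Nat.mod_mod] at h1
    · have := h3 k hk
      simp only [Bool.and_eq_false_iff, bne_eq_false_iff_eq, beq_eq_false_iff_ne]
      tauto

lemma step_ofExp_iff (hζ : IsPrimitiveRoot ζ N) (hN : N ≠ 0) {e : ℕ × ℕ × ℕ} {m : ℕ}
    {s : BicharTriple ℂ} :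
    Step m (ofExp ζ e) s ↔ ∃ e', stepExp N e = some (m, e') ∧ s = ofExp ζ e' := by
  simp only [Step, stepExp, force_eq, Option.map_eq_some_iff, Prod.mk.injEq]
  have key : (⟨(ζ ^ e.1) ^ (m ^ 2) * (ζ ^ e.2.1) ^ m * ζ ^ e.2.2,
      ((ζ ^ e.1) ^ (2 * m))⁻¹ * (ζ ^ e.2.1)⁻¹, ζ ^ e.1⟩ : BicharTriple ℂ) =
      ofExp ζ ((m ^ 2 * e.1 + m * e.2.1 + e.2.2) % N,
        ((N - 1) * (2 * m * e.1 + e.2.1)) % N, e.1) := by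
    simp only [ofExp, pow_mod_eq hζ, pow_pred_mul_eq hζ hN, pow_add, mul_inv]
    simp only [← pow_mul, mul_comm]
  constructor
  · rintro ⟨h1, rfl⟩
    exact ⟨_, ⟨m, (cartan_eq_some_iff hζ hN).2 h1, rfl, rfl⟩, key⟩
  · rintro ⟨_, ⟨m', h1, rfl, rfl⟩, rfl⟩
    exact ⟨(cartan_eq_some_iff hζ hN).1 h1, key.symm⟩

end PrimitiveRoot

lemma exists_eq_ofExp {N : ℕ} (hN : N ≠ 0) {s : BicharTriple ℂ} (h₁ : s.q₁ ^ N = 1)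
    (h : s.q ^ N = 1) (h₂ : s.q₂ ^ N = 1) :
    ∃ (ζ : ℂˣ) (e : ℕ × ℕ × ℕ), IsPrimitiveRoot ζ N ∧ (e.1 < N ∧ e.2.1 < N ∧ e.2.2 < N) ∧
      s = ofExp ζ e := by
  have hξ := Complex.isPrimitiveRoot_exp N hN
  obtain ⟨ζ, hζ⟩ := hξ.isUnit hN
  rw [← hζ] at hξ
  have hex : ∀ a : ℂˣ, a ^ N = 1 → ∃ i < N, a = ζ ^ i := by
    intro a ha
    have : NeZero N := ⟨hN⟩
    obtain ⟨i, hi, hi'⟩ := hξ.eq_pow_of_pow_eq_one (ξ := (a : ℂ)) (by rw [← Units.val_pow_eq_pow_val, ha, Units.val_one])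
    exact ⟨i, hi, Units.ext (by exact_mod_cast hi'.symm)⟩
  obtain ⟨x, hx, hx'⟩ := hex _ h₁
  obtain ⟨b, hb, hb'⟩ := hex _ h
  obtain ⟨y, hy, hy'⟩ := hex _ h₂
  exact ⟨ζ, (x, b, y), IsPrimitiveRoot.coe_units_iff.1 hξ, ⟨hx, hb, hy⟩,
    BicharTriple.ext hx' hb' hy'⟩

/-- The triple or the one with exchanged labels is in the table. -/
def InTable (s : BicharTriple ℂ) : Prop := ∃ w, AffineTable s w ∨ AffineTable s.swap w

lemma InTable.swap {s : BicharTriple ℂ} (h : InTable s) : InTable s.swap := by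
  obtain ⟨w, h⟩ := h
  exact ⟨w, h.symm⟩

/-- The rows of the table without a free parameter: the order of `ζ`, the exponents and the
period. -/
def tableRows : List (ℕ × (ℕ × ℕ × ℕ) × List ℕ) :=
  [(3, (1, 1, 1), [2]), (6, (2, 5, 2), [2]), (6, (1, 4, 4), [2]), (6, (4, 1, 2), [2]),
   (6, (2, 3, 2), [2]), (6, (2, 1, 4), [2]), (12, (1, 10, 4), [2]),
   (5, (1, 4, 4), [1, 4]), (8, (4, 4, 1), [1, 4]), (10, (1, 9, 4), [1, 4]),
   (12, (1, 10, 9), [2, 3, 1, 3]), (12, (9, 8, 4), [2, 3, 1, 3]),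
   (12, (1, 8, 6), [4, 1, 3, 3, 1]), (12, (6, 4, 3), [4, 1, 3, 3, 1]),
   (12, (3, 2, 9), [4, 1, 3, 3, 1]), (12, (9, 4, 6), [4, 1, 3, 3, 1]),
   (12, (6, 8, 7), [4, 1, 3, 3, 1]),
   (18, (1, 12, 9), [6, 1, 3, 1]), (18, (9, 6, 4), [6, 1, 3, 1])]

lemma affineTable_of_mem_tableRows {r : ℕ × (ℕ × ℕ × ℕ) × List ℕ} (hr : r ∈ tableRows) {ζ : ℂˣ}
    (hζ : IsPrimitiveRoot ζ r.1) : AffineTable (ofExp ζ r.2.1) r.2.2 := by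
  simp only [tableRows, List.mem_cons, List.not_mem_nil, or_false] at hr
  rcases hr with rfl | rfl | rfl | rfl | rfl | rfl | rfl | rfl | rfl | rfl | rfl | rfl | rfl | rfl |
    rfl | rfl | rfl | rfl | rfl
  · simpa only [ofExp, pow_one] using AffineTable.row1 ζ hζ
  · simpa only [ofExp, pow_one] using AffineTable.row2 ζ hζ
  · simpa only [ofExp, pow_one] using AffineTable.row3 ζ hζ
  · simpa only [ofExp, pow_one] using AffineTable.row4a ζ hζ
  · simpa only [ofExp, pow_one] using AffineTable.row4b ζ hζ
  · simpa only [ofExp, pow_one] using AffineTable.row4c ζ hζ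
  · simpa only [ofExp, pow_one] using AffineTable.row5 ζ hζ
  · simpa only [ofExp, pow_one] using AffineTable.row6 ζ hζ
  · simpa only [ofExp, pow_one] using AffineTable.row7 ζ hζ
  · simpa only [ofExp, pow_one] using AffineTable.row8 ζ hζ
  · simpa only [ofExp, pow_one] using AffineTable.row9a ζ hζ
  · simpa only [ofExp, pow_one] using AffineTable.row9b ζ hζ
  · simpa only [ofExp, pow_one] using AffineTable.row10a ζ hζ
  · simpa only [ofExp, pow_one] using AffineTable.row10b ζ hζ
  · simpa only [ofExp, pow_one] using AffineTable.row10c ζ hζ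
  · simpa only [ofExp, pow_one] using AffineTable.row10d ζ hζ
  · simpa only [ofExp, pow_one] using AffineTable.row10e ζ hζ
  · simpa only [ofExp, pow_one] using AffineTable.row11a ζ hζ
  · simpa only [ofExp, pow_one] using AffineTable.row11b ζ hζ

/-- Whether the powers of a primitive `N`-th root of unity with the given exponents form a triple of
one of the rows without a free parameter, up to the exchange of the labels. -/
def isRow (N : ℕ) (e : ℕ × ℕ × ℕ) : Bool :=
  tableRows.any fun r => N % r.1 == 0 && (List.range r.1).any fun k => Nat.gcd k r.1 == 1 &&
    force (N / r.1 * k) fun z =>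
      e == (z * r.2.1.1 % N, z * r.2.1.2.1 % N, z * r.2.1.2.2 % N) ||
        e == (z * r.2.1.2.2 % N, z * r.2.1.2.1 % N, z * r.2.1.1 % N)

lemma inTable_of_isRow {ζ : ℂˣ} {N : ℕ} (hζ : IsPrimitiveRoot ζ N) (hN : N ≠ 0) {e : ℕ × ℕ × ℕ}
    (h : isRow N e) : InTable (ofExp ζ e) := by
  simp only [isRow, List.any_eq_true, Bool.and_eq_true, beq_iff_eq, Bool.or_eq_true, force_eq] at h
  obtain ⟨r, hr, hd, k, -, hk, he⟩ := h
  generalize hz : N / r.1 * k = z at he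
  have hζ' : IsPrimitiveRoot (ζ ^ z) r.1 := by
    rw [← hz, pow_mul]
    exact (hζ.pow (Nat.pos_of_ne_zero hN)
      (Nat.div_mul_cancel (Nat.dvd_of_mod_eq_zero hd)).symm).pow_of_coprime _ hk
  have := affineTable_of_mem_tableRows hr hζ'
  obtain rfl | rfl := he
  · refine ⟨r.2.2, .inl ?_⟩
    simpa only [ofExp, pow_mod_eq hζ, pow_mul] using this
  · refine ⟨r.2.2, .inr ?_⟩
    simpa only [ofExp, swap, pow_mod_eq hζ, pow_mul] using this

/-! ### Refuting a word -/

/-- Run the deterministic system `step` for at most the given number of steps, and report whether it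
stops, or its output differs from the word `w`, or the recursion started with `f`, `g` does not stay
positive. -/
def refutes {σ : Type*} (step : σ → Option (ℕ × σ)) : ℕ → ℕ → ℕ → List ℕ → σ → Bool
  | 0, _, _, _, _ => false
  | n + 1, f, g, w, s =>
    match step s with
    | none => true
    | some (m, s') => w.head?.any (· != m) || Nat.ble (m * g) f ||
        force (m * g - f) fun g' => refutes step n g g' w.tail s'

/-- Two solutions of the recursion with `f v < g u` at the start keep this property (their Wronskian
is constant), so a positive solution forces the one starting with `0`, `1` to be positive. -/
lemma refutes_eq_false {σ : Type*} {step : σ → Option (ℕ × σ)} {c : ℤ → ℕ} {P : ℤ → σ → Prop}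
    (hstep : ∀ i s, P i s → ∃ s', step s = some (c i, s') ∧ P (i + 1) s') {n f g : ℕ}
    {w : List ℕ} {s : σ} {i : ℤ} {u v : ℤ} (hs : P i s) (hw : Occurs c i w)
    (hpos : StaysPositive u v (window c i n)) (huv : (f : ℤ) * v < g * u) :
    refutes step n f g w s = false := by
  induction n generalizing f g w s i u v with
  | zero => rfl
  | succ n ih =>
    obtain ⟨s', h1, h2⟩ := hstep i s hs
    obtain ⟨hu, hv, hpos'⟩ := hpos
    have hv' : 0 < c i * v - u := by
      cases n with
      | zero => exact hpos'.2
      | succ n => exact hpos'.2.1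
    have hlt : f < c i * g := by
      by_contra hle
      have h3 : ((c i * g : ℕ) : ℤ) * v ≤ f * v :=
        mul_le_mul_of_nonneg_right (by exact_mod_cast not_lt.1 hle) hv.le
      have h4 : (0 : ℤ) ≤ g * (c i * v - u) := by positivity
      push_cast at h3
      nlinarith
    have hw' : w.head?.any (· != c i) = false ∧ Occurs c (i + 1) w.tail := by
      cases w with
      | nil => exact ⟨rfl, occurs_nil _⟩
      | cons a w =>
        obtain ⟨rfl, h⟩ := occurs_cons.1 hw
        exact ⟨by simp, h⟩
    simp only [refutes, h1, hw'.1, Bool.false_or, force_eq]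
    rw [ih h2 hw'.2 hpos', Bool.or_false]
    · rw [← Bool.not_eq_true, Nat.ble_eq]; omega
    · push_cast [hlt.le]
      linarith

/-! ### Monomial relations -/

/-- The monomial with the given exponents. -/
def monomial (s : BicharTriple ℂ) (r : ℤ × ℤ × ℤ) : ℂˣ := s.q₁ ^ r.1 * s.q ^ r.2.1 * s.q₂ ^ r.2.2

/-- A linear combination of exponents. -/
def comb (m : ℤ) (r : ℤ × ℤ × ℤ) (n : ℤ) (r' : ℤ × ℤ × ℤ) : ℤ × ℤ × ℤ :=
  (m * r.1 + n * r'.1, m * r.2.1 + n * r'.2.1, m * r.2.2 + n * r'.2.2)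

lemma monomial_comb (s : BicharTriple ℂ) (m : ℤ) (r : ℤ × ℤ × ℤ) (n : ℤ) (r' : ℤ × ℤ × ℤ) :
    s.monomial (comb m r n r') = s.monomial r ^ m * s.monomial r' ^ n := by
  simp only [monomial, comb, mul_zpow, zpow_add, ← zpow_mul, mul_comm m, mul_comm n]
  simp only [mul_assoc, mul_left_comm]

/-- The triple of monomials with the given exponents. -/
def monomials (s : BicharTriple ℂ) (F : (ℤ × ℤ × ℤ) × (ℤ × ℤ × ℤ) × (ℤ × ℤ × ℤ)) :
    BicharTriple ℂ := ⟨s.monomial F.1, s.monomial F.2.1, s.monomial F.2.2⟩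

/-- The exponents of the monomials after one more step. -/
def stepForms (m : ℕ) (F : (ℤ × ℤ × ℤ) × (ℤ × ℤ × ℤ) × (ℤ × ℤ × ℤ)) :
    (ℤ × ℤ × ℤ) × (ℤ × ℤ × ℤ) × (ℤ × ℤ × ℤ) :=
  (comb 1 (comb (m ^ 2) F.1 m F.2.1) 1 F.2.2, comb (-2 * m) F.1 (-1) F.2.1, F.1)

lemma Step.eq_monomials {s s' : BicharTriple ℂ}
    {F : (ℤ × ℤ × ℤ) × (ℤ × ℤ × ℤ) × (ℤ × ℤ × ℤ)} {m : ℕ} (h : Step m (s.monomials F) s') :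
    s' = s.monomials (stepForms m F) := by
  rw [h.2]
  simp only [monomials, stepForms, monomial_comb, zpow_one, BicharTriple.mk.injEq, and_true]
  refine ⟨?_, ?_⟩
  · norm_cast
  · rw [neg_mul, zpow_neg, zpow_neg, zpow_one]
    norm_cast

/-- The exponents of the triple itself. -/
def initForms : (ℤ × ℤ × ℤ) × (ℤ × ℤ × ℤ) × (ℤ × ℤ × ℤ) := ((1, 0, 0), (0, 1, 0), (0, 0, 1))

lemma monomials_initForms (s : BicharTriple ℂ) : s.monomials initForms = s := by
  simp [monomials, initForms, monomial]

/-- The relation `q₁ ^ m * q = 1`. -/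
def relC (m : ℕ) (F : (ℤ × ℤ × ℤ) × (ℤ × ℤ × ℤ) × (ℤ × ℤ × ℤ)) : ℤ × ℤ × ℤ :=
  comb m F.1 1 F.2.1

/-- The relation `q₁ ^ (m + 1) = 1`. -/
def relR (m : ℕ) (F : (ℤ × ℤ × ℤ) × (ℤ × ℤ × ℤ) × (ℤ × ℤ × ℤ)) : ℤ × ℤ × ℤ :=
  comb (m + 1) F.1 0 F.1

lemma monomial_relC (s : BicharTriple ℂ) (m : ℕ)
    (F : (ℤ × ℤ × ℤ) × (ℤ × ℤ × ℤ) × (ℤ × ℤ × ℤ)) :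
    s.monomial (relC m F) = (s.monomials F).q₁ ^ m * (s.monomials F).q := by
  simp [relC, monomial_comb, monomials]

lemma monomial_relR (s : BicharTriple ℂ) (m : ℕ)
    (F : (ℤ × ℤ × ℤ) × (ℤ × ℤ × ℤ) × (ℤ × ℤ × ℤ)) :
    s.monomial (relR m F) = (s.monomials F).q₁ ^ (m + 1) := by
  simp only [relR, monomial_comb, monomials, zpow_zero, mul_one]
  norm_cast

/-- The determinant of three relations. -/
def det (r₁ r₂ r₃ : ℤ × ℤ × ℤ) : ℤ :=
  r₁.1 * (r₂.2.1 * r₃.2.2 - r₂.2.2 * r₃.2.1) - r₁.2.1 * (r₂.1 * r₃.2.2 - r₂.2.2 * r₃.1) +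
    r₁.2.2 * (r₂.1 * r₃.2.1 - r₂.2.1 * r₃.1)

/-- By Cramer's rule, three independent monomial relations make the entries of a triple roots of
unity of order dividing the determinant. -/
lemma pow_natAbs_det {s : BicharTriple ℂ} {r₁ r₂ r₃ : ℤ × ℤ × ℤ} (h₁ : s.monomial r₁ = 1)
    (h₂ : s.monomial r₂ = 1) (h₃ : s.monomial r₃ = 1) :
    s.q₁ ^ (det r₁ r₂ r₃).natAbs = 1 ∧ s.q ^ (det r₁ r₂ r₃).natAbs = 1 ∧
      s.q₂ ^ (det r₁ r₂ r₃).natAbs = 1 := by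
  simp only [pow_natAbs_eq_one]
  have key : ∀ a b c : ℤ, s.monomial (comb 1 (comb a r₁ b r₂) c r₃) = 1 := by
    intro a b c
    simp [monomial_comb, h₁, h₂, h₃]
  refine ⟨?_, ?_, ?_⟩
  · have := key (r₂.2.1 * r₃.2.2 - r₂.2.2 * r₃.2.1) (r₃.2.1 * r₁.2.2 - r₃.2.2 * r₁.2.1)
      (r₁.2.1 * r₂.2.2 - r₁.2.2 * r₂.2.1)
    rw [show comb 1 _ _ r₃ = (det r₁ r₂ r₃, 0, 0) from ?_] at this
    · simpa [monomial] using this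
    · simp only [comb, det, Prod.mk.injEq]
      refine ⟨by ring, by ring, by ring⟩
  · have := key (r₂.2.2 * r₃.1 - r₂.1 * r₃.2.2) (r₃.2.2 * r₁.1 - r₃.1 * r₁.2.2)
      (r₁.2.2 * r₂.1 - r₁.1 * r₂.2.2)
    rw [show comb 1 _ _ r₃ = (0, det r₁ r₂ r₃, 0) from ?_] at this
    · simpa [monomial] using this
    · simp only [comb, det, Prod.mk.injEq]
      refine ⟨by ring, by ring, by ring⟩
  · have := key (r₂.1 * r₃.2.1 - r₂.2.1 * r₃.1) (r₃.1 * r₁.2.1 - r₃.2.1 * r₁.1)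
      (r₁.1 * r₂.2.1 - r₁.2.1 * r₂.1)
    rw [show comb 1 _ _ r₃ = (0, 0, det r₁ r₂ r₃) from ?_] at this
    · simpa [monomial] using this
    · simp only [comb, det, Prod.mk.injEq]
      refine ⟨by ring, by ring, by ring⟩

/-! ### The check of the key words -/

/-- The exponents of a monomial modulo `N`. -/
def reduce (N : ℕ) (r : ℤ × ℤ × ℤ) : ℕ × ℕ × ℕ :=
  ((r.1 % N).toNat, (r.2.1 % N).toNat, (r.2.2 % N).toNat)

/-- Evaluation of `f` at a triple whose entries are computed first. -/
def forceTriple {α : Type*} (r : ℕ × ℕ × ℕ) (f : ℕ × ℕ × ℕ → α) : α :=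
  force r.1 fun a => force r.2.1 fun b => force r.2.2 fun c => f (a, b, c)

/-- Whether the exponents satisfy the relation modulo `N`. -/
def sat (N : ℕ) (r : ℕ × ℕ × ℕ) (x b y : ℕ) : Bool := (r.1 * x + r.2.1 * b + r.2.2 * y) % N == 0

lemma sat_of_monomial {ζ : ℂˣ} {N : ℕ} (hζ : IsPrimitiveRoot ζ N) (hN : N ≠ 0) {r : ℤ × ℤ × ℤ}
    {e : ℕ × ℕ × ℕ} (h : (ofExp ζ e).monomial r = 1) : sat N (reduce N r) e.1 e.2.1 e.2.2 := by
  have key : ∀ (a : ℤ) (k : ℕ), ζ ^ ((a % N).toNat * k) = (ζ ^ k) ^ a := by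
    intro a k
    rw [← zpow_natCast, ← zpow_natCast, ← zpow_mul, Nat.cast_mul,
      Int.toNat_of_nonneg (Int.emod_nonneg _ (by exact_mod_cast hN)), ← div_eq_one,
      div_eq_mul_inv, ← zpow_neg, ← zpow_add, ← sub_eq_add_neg, hζ.zpow_eq_one_iff_dvd, mul_comm (k : ℤ), ← sub_mul]
    refine Dvd.dvd.mul_right ?_ _
    rw [← dvd_neg, neg_sub]
    exact Int.dvd_self_sub_emod
  rw [sat, beq_iff_eq, ← pow_eq_one_iff_mod hζ, ← h]
  simp only [monomial, ofExp, pow_add, reduce, key]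

/-- A list containing all `y < N` with `k + c * y = 0` modulo `N`. -/
def solve (N c k : ℕ) : List ℕ :=
  if c = 0 then if k % N = 0 then List.range N else []
  else (List.range (c + 1)).filterMap fun t =>
    if (N * t - k % N) % c = 0 then some ((N * t - k % N) / c) else none

lemma mem_solve {N c k y : ℕ} (hy : y < N) (h : (k + c * y) % N = 0) : y ∈ solve N c k := by
  obtain hc | hc := Nat.eq_zero_or_pos c
  · subst hc
    rw [zero_mul, add_zero] at h
    simp [solve, h, hy]
  · rw [← Nat.mod_add_mod] at h
    have hk : k % N < N := Nat.mod_lt _ (by omega)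
    simp only [solve, hc.ne', if_false, List.mem_filterMap, List.mem_range]
    generalize k % N = a at h hk ⊢
    obtain ⟨t, ht⟩ := Nat.dvd_of_mod_eq_zero h
    refine ⟨t, ?_, ?_⟩
    · have h1 : c * y ≤ c * (N - 1) := Nat.mul_le_mul_left c (by omega)
      have h2 : N * t < N * (c + 1) := by
        rw [← ht, mul_add, mul_one, mul_comm N c]
        have h3 : c * (N - 1) ≤ c * N := Nat.mul_le_mul_left c (by omega)
        omega
      exact Nat.lt_of_mul_lt_mul_left h2
    · have h3 : N * t - a = c * y := by omega
      rw [h3, Nat.mul_mod_right, Nat.mul_div_cancel_left _ hc, if_pos rfl]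

/-- Whether each triple of `N`-th roots of unity with the given three relations is in the table or
contradicts the word; twelve steps suffice to see this for all key words. The first relation must
not involve the last entry. -/
def checkMod (w : List ℕ) (N : ℕ) (r₁ r₂ r₃ : ℕ × ℕ × ℕ) : Bool :=
  N != 0 && r₁.2.2 == 0 && (List.range N).all fun x =>
    force (r₁.1 * x) fun k => (solve N r₁.2.1 k).all fun b => force b fun b =>
      force (r₂.1 * x + r₂.2.1 * b) fun k => (solve N r₂.2.2 k).all fun y => force y fun y =>
        !sat N r₃ x b y || refutes (stepExp N) 12 0 1 w (x, b, y) || isRow N (x, b, y)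

/-- The check for all triples with the given three relations. -/
def checkRel (w : List ℕ) (r₁ r₂ r₃ : ℤ × ℤ × ℤ) : Bool :=
  force (det r₁ r₂ r₃).natAbs fun N => forceTriple (reduce N r₁) fun a₁ =>
    forceTriple (reduce N r₂) fun a₂ => forceTriple (reduce N r₃) fun a₃ => checkMod w N a₁ a₂ a₃

/-- Two integers that alternate, as a deterministic system. -/
def stepAlternate (m : ℕ × ℕ) : Option (ℕ × (ℕ × ℕ)) := some (m.1, (m.2, m.1))

/-- The check of a word. Each integer comes from one of the two alternatives, and this gives a
monomial relation. If the second integer comes from the order of the label, then the relations at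
the first three positions are independent. Otherwise the third label equals the first one, so the
relation at the third position is useless; unless all triples are alternatingly the same, the one at
the fourth position can be used instead. -/
def checkWord : List ℕ → Bool
  | m₀ :: m₁ :: m₂ :: w =>
    let F₁ := stepForms m₀ initForms
    let F₂ := stepForms m₁ F₁
    let F₃ := stepForms m₂ F₂
    let w' := m₀ :: m₁ :: m₂ :: w
    [relC m₀ initForms, relR m₀ initForms].all (fun r₁ =>
      [relC m₂ F₂, relR m₂ F₂].all fun r₃ => checkRel w' r₁ (relR m₁ F₁) r₃) &&
    (m₀ != m₂ || match w with
      | [] => false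
      | m₃ :: _ => [relC m₃ F₃, relR m₃ F₃].all fun r₃ =>
        checkRel w' (relR m₀ initForms) (relC m₁ F₁) r₃) &&
    ((m₀, m₁) == (2, 2) || (m₀, m₁) == (1, 4) || refutes stepAlternate 12 0 1 w' (m₀, m₁))
  | _ => false

lemma checkWord_of_mem {w : List ℕ} (hw : w ∈ keyWords) : checkWord w := by
  revert w
  decide +kernel

lemma inTable_of_checkMod {w : List ℕ} {N : ℕ} {r₁ r₂ r₃ : ℕ × ℕ × ℕ}
    (h : checkMod w N r₁ r₂ r₃) {ζ : ℂˣ} (hζ : IsPrimitiveRoot ζ N) {e : ℕ × ℕ × ℕ}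
    (he : e.1 < N ∧ e.2.1 < N ∧ e.2.2 < N) (h₁ : sat N r₁ e.1 e.2.1 e.2.2)
    (h₂ : sat N r₂ e.1 e.2.1 e.2.2) (h₃ : sat N r₃ e.1 e.2.1 e.2.2)
    (hw : refutes (stepExp N) 12 0 1 w e = false) : InTable (ofExp ζ e) := by
  simp only [checkMod, force_eq, Bool.and_eq_true, bne_iff_ne, beq_iff_eq, List.all_eq_true,
    List.mem_range, Bool.or_eq_true, Bool.not_eq_true'] at h
  obtain ⟨⟨hN, h0⟩, h⟩ := h
  simp only [sat, beq_iff_eq] at h₁ h₂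
  rw [h0, zero_mul, add_zero] at h₁
  have := h e.1 he.1 e.2.1 (mem_solve he.2.1 h₁) e.2.2 (mem_solve he.2.2 h₂)
  rw [h₃, hw] at this
  exact inTable_of_isRow hζ hN (by simpa using this)

section Chain

variable {S : ℤ → BicharTriple ℂ} {c : ℤ → ℕ} {w : List ℕ} {i : ℤ}

/-- For a triple of roots of unity the computed sequence is the characteristic sequence, so if the
latter comes from an affine sequence and contains the word, then the word is not refuted. -/
lemma IsChain.refutes_eq_false (h : IsChain S c)
    (hpos : ∀ i l, Occurs c i l → ∃ u v, StaysPositive u v l) (hw : Occurs c i w) {ζ : ℂˣ} {N : ℕ}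
    (hζ : IsPrimitiveRoot ζ N) (hN : N ≠ 0) {e : ℕ × ℕ × ℕ} (he : S i = ofExp ζ e) :
    refutes (stepExp N) 12 0 1 w e = false := by
  obtain ⟨u, v, huv⟩ := hpos i _ (occurs_window i 12)
  refine BicharTriple.refutes_eq_false (P := fun i e => S i = ofExp ζ e) (fun i e he => ?_) he hw
    huv (by simpa using huv.1)
  have := h i
  rw [he, step_ofExp_iff hζ hN] at this
  exact this

lemma IsChain.inTable_of_checkRel (h : IsChain S c)
    (hpos : ∀ i l, Occurs c i l → ∃ u v, StaysPositive u v l) (hw : Occurs c i w)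
    {r₁ r₂ r₃ : ℤ × ℤ × ℤ} (hr : checkRel w r₁ r₂ r₃) (h₁ : (S i).monomial r₁ = 1)
    (h₂ : (S i).monomial r₂ = 1) (h₃ : (S i).monomial r₃ = 1) : InTable (S i) := by
  simp only [checkRel, forceTriple, force_eq] at hr
  obtain ⟨hd₁, hd, hd₂⟩ := pow_natAbs_det h₁ h₂ h₃
  have hN : (det r₁ r₂ r₃).natAbs ≠ 0 := by
    simp only [checkMod, Bool.and_eq_true, bne_iff_ne] at hr
    exact hr.1.1
  obtain ⟨ζ, e, hζ, he, hS⟩ := exists_eq_ofExp hN hd₁ hd hd₂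
  have hw' := h.refutes_eq_false hpos hw hζ hN hS
  rw [hS] at h₁ h₂ h₃ ⊢
  exact inTable_of_checkMod hr hζ he (sat_of_monomial hζ hN h₁) (sat_of_monomial hζ hN h₂)
    (sat_of_monomial hζ hN h₃) hw'

lemma IsChain.refutes_alternate_eq_false (h : IsChain S c) (h0 : (S i).q₁ ^ c i * (S i).q = 1)
    (h1 : (S (i + 1)).q₁ ^ c (i + 1) * (S (i + 1)).q = 1) (hpos : ∀ i l, Occurs c i l →
      ∃ u v, StaysPositive u v l) (hw : Occurs c i w) :
    refutes stepAlternate 12 0 1 w (c i, c (i + 1)) = false := by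
  obtain ⟨u, v, huv⟩ := hpos i _ (occurs_window i 12)
  refine BicharTriple.refutes_eq_false (P := fun i m => m = (c i, c (i + 1)) ∧
    (S i).q₁ ^ c i * (S i).q = 1 ∧ (S (i + 1)).q₁ ^ c (i + 1) * (S (i + 1)).q = 1) ?_
    ⟨rfl, h0, h1⟩ hw huv (by simpa using huv.1)
  rintro i _ ⟨rfl, h0, h1⟩
  obtain ⟨h2, h3⟩ := h.alternate h0 h1
  rw [show i + 2 = i + 1 + 1 by ring] at h2 h3
  exact ⟨_, rfl, by rw [h2], h1, h3⟩

/-- If both integers of a triple come from relations `q₁ ^ m * q = 1`, then the triple is in one of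
the rows with a free parameter. -/
lemma inTable_of_two_relations {s s' : BicharTriple ℂ} {m n : ℕ} (hm : Step m s s')
    (hn : IsCartanEntry s'.q₁ s'.q n) (h0 : s.q₁ ^ m * s.q = 1) (h1 : s'.q₁ ^ n * s'.q = 1)
    (hmn : (m, n) = (2, 2) ∨ (m, n) = (1, 4)) : InTable s := by
  have hs := hm.eq_swap h0
  replace hm := hm.1
  subst hs
  obtain ⟨x, b, y⟩ := s
  simp only [swap] at hm hn h0 h1
  simp only [Prod.mk.injEq] at hmn
  obtain ⟨rfl, rfl⟩ | ⟨rfl, rfl⟩ := hmn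
  · have hx1 : x ≠ 1 := hm.ne_one (by norm_num) h0
    have hx2 : x ≠ -1 := by
      rintro rfl
      exact hm.pow_succ_ne_one (k := 1) (by norm_num) h0 (by norm_num)
    obtain rfl := eq_inv_of_mul_eq_one_right h0
    have hxy : y ^ 2 = x ^ 2 := by rwa [mul_inv_eq_one] at h1
    replace hxy : y = x ∨ y = -x := by
      simpa [Units.ext_iff, sq_eq_sq_iff_eq_or_eq_neg] using congrArg Units.val hxy
    obtain rfl | rfl := hxy
    · exact ⟨_, .inl (.row12 _ hx1 hx2)⟩
    · exact ⟨_, .inl (.row13 _ hx1 hx2)⟩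
  · obtain rfl := eq_inv_of_mul_eq_one_right h1
    rw [pow_one, mul_inv_eq_one] at h0
    subst h0
    refine ⟨_, .inr (.row14 y (hn.ne_one (by norm_num) h1) ?_ ?_ ?_)⟩
    · rintro rfl
      exact hn.pow_succ_ne_one (k := 1) (by norm_num) h1 (by norm_num)
    · exact fun h => hn.pow_succ_ne_one (k := 2) (by norm_num) h1 h.pow_eq_one
    · exact fun h => hn.pow_succ_ne_one (k := 3) (by norm_num) h1 h.pow_eq_one

/-- A word that passes the check can occur in an affine characteristic sequence only at a triple of
the table. -/
theorem IsChain.inTable_of_checkWord (h : IsChain S c)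
    (hpos : ∀ i l, Occurs c i l → ∃ u v, StaysPositive u v l) (hw : Occurs c i w)
    (hc : checkWord w) : InTable (S i) := by
  match w, hc with
  | m₀ :: m₁ :: m₂ :: w, hc =>
  simp only [checkWord, List.all_cons, List.all_nil, Bool.and_true, Bool.and_eq_true,
    Bool.or_eq_true, bne_iff_ne, beq_iff_eq] at hc
  obtain ⟨⟨⟨⟨hCC, hCR⟩, hRC, hRR⟩, h3⟩, h4⟩ := hc
  obtain ⟨rfl, hw1⟩ := occurs_cons.1 hw
  obtain ⟨rfl, hw2⟩ := occurs_cons.1 hw1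
  obtain ⟨rfl, hw3⟩ := occurs_cons.1 hw2
  -- the alternatives for the relation at a position, in terms of the triple at position `i`
  have alt : ∀ (j : ℤ) F, S j = (S i).monomials F →
      ((S i).monomial (relC (c j) F) = 1 ∨ (S i).monomial (relR (c j) F) = 1) ∧
        S (j + 1) = (S i).monomials (stepForms (c j) F) := by
    intro j F hF
    have hj := h j
    have := (isCartanEntry_iff.1 hj.1).1
    rw [hF] at hj this
    rw [monomial_relC, monomial_relR]
    exact ⟨this.symm.imp_right And.right, hj.eq_monomials⟩
  have e0 : S i = (S i).monomials initForms := (monomials_initForms _).symm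
  obtain ⟨a0, e1⟩ := alt i _ e0
  obtain ⟨a1, e2⟩ := alt _ _ e1
  obtain ⟨a2, e3⟩ := alt _ _ e2
  obtain a1 | a1 := a1
  swap
  · obtain a0 | a0 := a0 <;> obtain a2 | a2 := a2
    · exact h.inTable_of_checkRel hpos hw hCC a0 a1 a2
    · exact h.inTable_of_checkRel hpos hw hCR a0 a1 a2
    · exact h.inTable_of_checkRel hpos hw hRC a0 a1 a2
    · exact h.inTable_of_checkRel hpos hw hRR a0 a1 a2
  have h1 : (S (i + 1)).q₁ ^ c (i + 1) * (S (i + 1)).q = 1 := by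
    rw [e1, ← monomial_relC, a1]
  obtain a0 | a0 := a0
  · have h0 : (S i).q₁ ^ c i * (S i).q = 1 := by
      rw [monomial_relC, monomials_initForms] at a0
      exact a0
    rw [h.refutes_alternate_eq_false h0 h1 hpos hw] at h4
    exact inTable_of_two_relations (h i) (h (i + 1)).1 h0 h1 (by simpa using h4)
  · -- the second reflection fixes the triple, so the third integer equals the first one
    have h02 : c i = c (i + 1 + 1) := by
      have h5 := h (i + 1 + 1)
      rw [(h (i + 1)).eq_swap h1] at h5
      exact ((h i).symm.unique h5).1
    replace h3 := h3.resolve_left (not_not.2 h02)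
    cases w with
    | nil => simp at h3
    | cons m₃ w =>
      obtain ⟨rfl, -⟩ := occurs_cons.1 hw3
      rw [Bool.and_eq_true] at h3
      obtain a3 | a3 := (alt _ _ e3).1
      · exact h.inTable_of_checkRel hpos hw h3.1 a0 a1 a3
      · exact h.inTable_of_checkRel hpos hw h3.2 a0 a1 a3

end Chain

end BicharTriple

/-! ### The characteristic sequences of the triples in the table -/

lemma hasPeriodWord_of_getD {c : ℤ → ℕ} {w : List ℕ} (t : ℤ)
    (h : ∀ i : ℤ, c i = w.getD ((i + t) % w.length).toNat 0) : HasPeriodWord c w := by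
  refine ⟨-t, fun n j hj => ?_⟩
  rw [h, show -t + n * w.length + j + t = j + n * w.length by ring, Int.add_mul_emod_self_right,
    Int.emod_eq_of_lt (by omega) (by omega), Int.toNat_natCast]

namespace BicharTriple

lemma isCartanEntry_of_pow {a b : ℂˣ} {m : ℕ} (h : a ^ m * b = 1)
    (ha : ∀ k, 0 < k → k ≤ m → a ^ k ≠ 1) : IsCartanEntry a b m := by
  refine isCartanEntry_iff.2 ⟨.inr h, fun k hk hk' => ?_⟩
  obtain hk' | hk' := hk'
  · exact ha (k + 1) (by omega) hk hk'.2
  · rw [← h, mul_left_inj, ← Nat.sub_add_cancel hk.le, pow_add] at hk'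
    exact ha (m - k) (by omega) (by omega) (by simpa using hk'.symm)

/-- A triple in the table is in one of the rows without a free parameter, or both reflections fix
it. -/
lemma affineTable_cases {s : BicharTriple ℂ} {w : List ℕ} (h : AffineTable s w) :
    (∃ r ∈ tableRows, ∃ ζ : ℂˣ, IsPrimitiveRoot ζ r.1 ∧ s = ofExp ζ r.2.1 ∧ w = r.2.2) ∨
      ∃ m n : ℕ, (s.q₁ ^ m * s.q = 1 ∧ IsCartanEntry s.q₁ s.q m) ∧
        (s.q₂ ^ n * s.q = 1 ∧ IsCartanEntry s.q₂ s.q n) ∧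
        (m = 2 ∧ n = 2 ∧ w = [2] ∨ m = 4 ∧ n = 1 ∧ w = [1, 4]) := by
  have key : ∀ r ∈ tableRows, ∀ ζ : ℂˣ, IsPrimitiveRoot ζ r.1 → ofExp ζ r.2.1 = s → r.2.2 = w →
      ∃ r ∈ tableRows, ∃ ζ : ℂˣ, IsPrimitiveRoot ζ r.1 ∧ s = ofExp ζ r.2.1 ∧ w = r.2.2 :=
    fun r hr ζ h1 h2 h3 => ⟨r, hr, ζ, h1, h2.symm, h3.symm⟩
  have two : ∀ q : ℂˣ, q ≠ 1 → q ≠ -1 → ∀ k, 0 < k → k ≤ 2 → q ^ k ≠ 1 := by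
    intro q h1 h2 k hk hk' h
    interval_cases k
    · exact h1 (by simpa using h)
    · have := congrArg Units.val h
      rw [Units.val_pow_eq_pow_val, sq, Units.val_one, mul_self_eq_one_iff] at this
      obtain h | h := this
      · exact h1 (Units.ext h)
      · exact h2 (Units.ext h)
  cases h with
  | row12 q h1 h2 =>
    have h := isCartanEntry_of_pow (mul_inv_cancel (q ^ 2)) (two q h1 h2)
    exact .inr ⟨2, 2, ⟨mul_inv_cancel _, h⟩, ⟨mul_inv_cancel _, h⟩, .inl ⟨rfl, rfl, rfl⟩⟩
  | row13 q h1 h2 =>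
    have h : (-q) ^ 2 * (q ^ 2)⁻¹ = 1 := by rw [neg_sq, mul_inv_cancel]
    exact .inr ⟨2, 2, ⟨mul_inv_cancel _, isCartanEntry_of_pow (mul_inv_cancel _) (two q h1 h2)⟩,
      ⟨h, isCartanEntry_of_pow h
        (two (-q) (by rwa [ne_eq, neg_eq_iff_eq_neg]) (by rwa [ne_eq, neg_inj]))⟩,
      .inl ⟨rfl, rfl, rfl⟩⟩
  | row14 q h1 h2 h3 h4 =>
    have three : q ^ 3 ≠ 1 := fun h => h3 (.mk_of_lt q (by norm_num) h fun l hl hl' =>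
      two q h1 h2 l hl (by omega))
    have four : ∀ k, 0 < k → k ≤ 4 → q ^ k ≠ 1 := by
      intro k hk hk' h
      obtain h5 | rfl | rfl : k ≤ 2 ∨ k = 3 ∨ k = 4 := by omega
      · exact two q h1 h2 k hk h5 h
      · exact three h
      · refine h4 (.mk_of_lt q (by norm_num) h fun l hl hl' => ?_)
        obtain h5 | rfl : l ≤ 2 ∨ l = 3 := by omega
        · exact two q h1 h2 l hl h5
        · exact three
    have h : (q ^ 4) ^ 1 * (q ^ 4)⁻¹ = 1 := by rw [pow_one, mul_inv_cancel]
    refine .inr ⟨4, 1, ⟨mul_inv_cancel _, isCartanEntry_of_pow (mul_inv_cancel _) four⟩,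
      ⟨h, isCartanEntry_of_pow h fun k hk hk' => ?_⟩, .inr ⟨rfl, rfl, rfl⟩⟩
    rw [← pow_mul, show 4 * k = 4 by omega]
    exact four 4 (by norm_num) le_rfl
  | row1 ζ hζ =>
    exact .inl (key (3, (1, 1, 1), [2]) (by simp [tableRows]) ζ hζ (by simp [ofExp]) rfl)
  | row2 ζ hζ =>
    exact .inl (key (6, (2, 5, 2), [2]) (by simp [tableRows]) ζ hζ (by simp [ofExp]) rfl)
  | row3 ζ hζ =>
    exact .inl (key (6, (1, 4, 4), [2]) (by simp [tableRows]) ζ hζ (by simp [ofExp]) rfl)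
  | row4a ζ hζ =>
    exact .inl (key (6, (4, 1, 2), [2]) (by simp [tableRows]) ζ hζ (by simp [ofExp]) rfl)
  | row4b ζ hζ =>
    exact .inl (key (6, (2, 3, 2), [2]) (by simp [tableRows]) ζ hζ (by simp [ofExp]) rfl)
  | row4c ζ hζ =>
    exact .inl (key (6, (2, 1, 4), [2]) (by simp [tableRows]) ζ hζ (by simp [ofExp]) rfl)
  | row5 ζ hζ =>
    exact .inl (key (12, (1, 10, 4), [2]) (by simp [tableRows]) ζ hζ (by simp [ofExp]) rfl)
  | row6 ζ hζ =>
    exact .inl (key (5, (1, 4, 4), [1, 4]) (by simp [tableRows]) ζ hζ (by simp [ofExp]) rfl)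
  | row7 ζ hζ =>
    exact .inl (key (8, (4, 4, 1), [1, 4]) (by simp [tableRows]) ζ hζ (by simp [ofExp]) rfl)
  | row8 ζ hζ =>
    exact .inl (key (10, (1, 9, 4), [1, 4]) (by simp [tableRows]) ζ hζ (by simp [ofExp]) rfl)
  | row9a ζ hζ =>
    exact .inl (key (12, (1, 10, 9), [2, 3, 1, 3]) (by simp [tableRows]) ζ hζ (by simp [ofExp]) rfl)
  | row9b ζ hζ =>
    exact .inl (key (12, (9, 8, 4), [2, 3, 1, 3]) (by simp [tableRows]) ζ hζ (by simp [ofExp]) rfl)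
  | row10a ζ hζ =>
    exact .inl (key (12, (1, 8, 6), [4, 1, 3, 3, 1]) (by simp [tableRows]) ζ hζ (by simp [ofExp]) rfl)
  | row10b ζ hζ =>
    exact .inl (key (12, (6, 4, 3), [4, 1, 3, 3, 1]) (by simp [tableRows]) ζ hζ (by simp [ofExp]) rfl)
  | row10c ζ hζ =>
    exact .inl (key (12, (3, 2, 9), [4, 1, 3, 3, 1]) (by simp [tableRows]) ζ hζ (by simp [ofExp]) rfl)
  | row10d ζ hζ =>
    exact .inl (key (12, (9, 4, 6), [4, 1, 3, 3, 1]) (by simp [tableRows]) ζ hζ (by simp [ofExp]) rfl)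
  | row10e ζ hζ =>
    exact .inl (key (12, (6, 8, 7), [4, 1, 3, 3, 1]) (by simp [tableRows]) ζ hζ (by simp [ofExp]) rfl)
  | row11a ζ hζ =>
    exact .inl (key (18, (1, 12, 9), [6, 1, 3, 1]) (by simp [tableRows]) ζ hζ (by simp [ofExp]) rfl)
  | row11b ζ hζ =>
    exact .inl (key (18, (9, 6, 4), [6, 1, 3, 1]) (by simp [tableRows]) ζ hζ (by simp [ofExp]) rfl)

/-- The next exponents, if they are defined. -/
def nextExp (N : ℕ) (e : ℕ × ℕ × ℕ) : ℕ × ℕ × ℕ := ((stepExp N e).map Prod.snd).getD e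

/-- The integer, if it is defined. -/
def intExp (N : ℕ) (e : ℕ × ℕ × ℕ) : ℕ := ((stepExp N e).map Prod.fst).getD 0

/-- Whether the exponents return to themselves after `L` steps, all integers on the way are
defined and spell the word `w`, cyclically, from its `t`-th letter on, and all triples are in the
table. -/
def isOrbit (N : ℕ) (w : List ℕ) (L t : ℕ) (e : ℕ × ℕ × ℕ) : Bool :=
  L != 0 && (nextExp N)^[L] e == e && L % w.length == 0 && (List.range L).all fun k =>
    (stepExp N ((nextExp N)^[k] e)).isSome && isRow N ((nextExp N)^[k] e) &&
      intExp N ((nextExp N)^[k] e) == w.getD ((k + t) % w.length) 0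

lemma isOrbit_of_mem {r : ℕ × (ℕ × ℕ × ℕ) × List ℕ} (hr : r ∈ tableRows)
    {e : ℕ × ℕ × ℕ} (he : e = r.2.1 ∨ e = (r.2.1.2.2, r.2.1.2.1, r.2.1.1)) :
    r.1 ≠ 0 ∧ ∃ L < 11, ∃ t < 5, isOrbit r.1 r.2.2 L t e := by
  have key : ∀ r ∈ tableRows, ∀ e ∈ [r.2.1, (r.2.1.2.2, r.2.1.2.1, r.2.1.1)],
      r.1 ≠ 0 ∧ ∃ L < 11, ∃ t < 5, isOrbit r.1 r.2.2 L t e := by decide +kernel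
  exact key r hr e (by simpa using he)

/-- `w` is the period of the characteristic sequence of `s`, and the table contains all triples that
are obtained from `s` by reflections. -/
def HasTableOrbit (s : BicharTriple ℂ) (w : List ℕ) : Prop :=
  ∃ S c, S 0 = s ∧ IsChain S c ∧ (∀ i, InTable (S i)) ∧ HasPeriodWord c w

lemma hasTableOrbit_of_isOrbit {ζ : ℂˣ} {N : ℕ} (hζ : IsPrimitiveRoot ζ N) (hN : N ≠ 0)
    {w : List ℕ} {L t : ℕ} {e : ℕ × ℕ × ℕ} (h : isOrbit N w L t e) :
    HasTableOrbit (ofExp ζ e) w := by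
  simp only [isOrbit, Bool.and_eq_true, bne_iff_ne, beq_iff_eq, List.all_eq_true,
    List.mem_range, and_assoc] at h
  obtain ⟨hL, hper, hw, h⟩ := h
  have hlt : ∀ i : ℤ, (i % L).toNat < L := fun i => by
    have := Int.emod_lt_of_pos i (by omega : (0 : ℤ) < L)
    omega
  have hper' : Function.Periodic (fun k => (nextExp N)^[k] e) L := fun k => by
    simp only [Function.iterate_add_apply, hper]
  refine ⟨fun i => ofExp ζ ((nextExp N)^[(i % L).toNat] e),
    fun i => intExp N ((nextExp N)^[(i % L).toNat] e), by simp, fun i => ?_, fun i => ?_, ?_⟩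
  · rw [step_ofExp_iff hζ hN]
    have e1 : (nextExp N)^[((i + 1) % L).toNat] e = nextExp N ((nextExp N)^[(i % L).toNat] e) := by
      have := hper'.map_mod_nat ((i % L).toNat + 1)
      rw [Function.iterate_succ_apply'] at this
      rw [← this]
      congr 2
      have h1 : ((i % L).toNat : ℤ) = i % L := Int.toNat_of_nonneg (Int.emod_nonneg _ (by omega))
      have h2 : (i + 1) % L = ((((i % L).toNat + 1) % L : ℕ) : ℤ) := by
        push_cast
        rw [h1, Int.emod_add_emod]
      rw [h2, Int.toNat_natCast]
    obtain ⟨x, hx⟩ := Option.isSome_iff_exists.1 (h _ (hlt i)).1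
    exact ⟨x.2, by simp [hx, intExp], by simp only [e1]; simp [nextExp, hx]⟩
  · exact inTable_of_isRow hζ hN (h _ (hlt i)).2.1
  · refine hasPeriodWord_of_getD t fun i => ?_
    rw [(h _ (hlt i)).2.2]
    congr 1
    have h1 : ((i % L).toNat : ℤ) = i % L := Int.toNat_of_nonneg (Int.emod_nonneg _ (by omega))
    rw [← Int.toNat_natCast (((i % L).toNat + t) % w.length)]
    congr 1
    push_cast
    rw [h1, ← Int.emod_add_emod (i % L), Int.emod_emod_of_dvd _ (by
      exact_mod_cast Nat.dvd_of_mod_eq_zero hw), Int.emod_add_emod]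

lemma hasTableOrbit_of_two_relations {s : BicharTriple ℂ} {w : List ℕ} {m n : ℕ} (hs : InTable s)
    (hm : s.q₁ ^ m * s.q = 1 ∧ IsCartanEntry s.q₁ s.q m)
    (hn : s.q₂ ^ n * s.q = 1 ∧ IsCartanEntry s.q₂ s.q n)
    (h : ∃ t, ∀ i : ℤ, (if Even i then m else n) = w.getD ((i + t) % w.length).toNat 0) :
    HasTableOrbit s w := by
  obtain ⟨t, h⟩ := h
  have key : ∀ (s : BicharTriple ℂ) (m : ℕ), s.q₁ ^ m * s.q = 1 → IsCartanEntry s.q₁ s.q m →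
      Step m s s.swap := by
    intro s m h1 h2
    have h3 : Step m s _ := ⟨h2, rfl⟩
    have h4 := h3.eq_swap h1
    rwa [h4] at h3
  refine ⟨fun i => if Even i then s else s.swap, fun i => if Even i then m else n, by simp,
    fun i => ?_, fun i => ?_, hasPeriodWord_of_getD t h⟩
  · by_cases hi : Even i
    · have hi' : ¬ Even (i + 1) := by simpa [Int.even_add_one] using hi
      simp only [hi, hi', if_true, if_false]
      exact key s m hm.1 hm.2
    · have hi' : Even (i + 1) := by simpa [Int.even_add_one] using hi
      simp only [hi, hi', if_true, if_false]
      exact key s.swap n hn.1 hn.2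
  · by_cases hi : Even i
    · simpa [hi] using hs
    · simpa [hi] using hs.swap

theorem hasTableOrbit {s : BicharTriple ℂ} {w : List ℕ}
    (h : AffineTable s w ∨ AffineTable s.swap w) : HasTableOrbit s w := by
  have hs : InTable s := ⟨w, h⟩
  have word : ∀ m n : ℕ, (m = 2 ∧ n = 2 ∧ w = [2] ∨ m = 4 ∧ n = 1 ∧ w = [1, 4]) →
      (∃ t : ℤ, ∀ i : ℤ, (if Even i then m else n) = w.getD ((i + t) % w.length).toNat 0) ∧
      ∃ t : ℤ, ∀ i : ℤ, (if Even i then n else m) = w.getD ((i + t) % w.length).toNat 0 := by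
    rintro m n (⟨rfl, rfl, rfl⟩ | ⟨rfl, rfl, rfl⟩)
    · exact ⟨⟨0, fun i => by simp⟩, ⟨0, fun i => by simp⟩⟩
    · refine ⟨⟨1, fun i => ?_⟩, ⟨0, fun i => ?_⟩⟩ <;>
        obtain hi | hi := Int.emod_two_eq_zero_or_one i <;>
        simp [Int.even_iff, hi, Int.add_emod]
  obtain h | h := h <;>
    obtain ⟨r, hr, ζ, hζ, hs', rfl⟩ | ⟨m, n, hm, hn, hw⟩ := affineTable_cases h
  · obtain ⟨hN, L, -, t, -, ho⟩ := isOrbit_of_mem hr (.inl rfl)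
    rw [hs']
    exact hasTableOrbit_of_isOrbit hζ hN ho
  · exact hasTableOrbit_of_two_relations hs hm hn (word m n hw).1
  · obtain ⟨hN, L, -, t, -, ho⟩ := isOrbit_of_mem hr (.inr rfl)
    rw [← swap_swap s, hs']
    exact hasTableOrbit_of_isOrbit hζ hN ho
  · exact hasTableOrbit_of_two_relations hs hn hm (word m n hw).2

end BicharTriple

/-! ### Affine periodic sequences -/

/-- Gluing quiddity cycles periodically: the cycles in the list `Q` are placed at the positions in
the list `o` within the period `w`. -/
lemma HasPeriodWord.isAffineSeq {c : ℤ → ℕ} {w : List ℕ} (h : HasPeriodWord c w)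
    (Q : List (List ℕ)) (o : List ℕ) (hQ : ∀ l ∈ Q, IsQuiddity l) (hQ0 : Q ≠ [])
    (ho0 : o.getD 0 0 = 0) (hoQ : o.getD Q.length 0 = w.length)
    (ho : ∀ r < Q.length, 2 ≤ (Q.getD r []).length ∧
      o.getD (r + 1) 0 = o.getD r 0 + ((Q.getD r []).length - 1) ∧ o.getD (r + 1) 0 ≤ w.length ∧
      w.getD (o.getD r 0) 0 =
        (Q.getD ((r + (Q.length - 1)) % Q.length) []).getLastD 0 + 2 + (Q.getD r []).headD 0 ∧
      ∀ j < (Q.getD r []).length, 0 < j → j + 1 < (Q.getD r []).length →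
        w.getD (o.getD r 0 + j) 0 = (Q.getD r []).getD j 0) : IsAffineSeq c := by
  obtain ⟨s, h⟩ := h
  have hq : 0 < Q.length := List.length_pos_iff.2 hQ0
  generalize hqe : Q.length = q at *
  refine ⟨fun k => Q.getD (k % q).toNat [],
    fun k => s + k / q * w.length + o.getD (k % q).toNat 0, fun k => ?_⟩
  obtain ⟨r, hr⟩ : ∃ r : ℕ, k % q = r := Int.eq_ofNat_of_zero_le (Int.emod_nonneg _ (by omega))
  have hrq : r < q := by
    have := Int.emod_lt_of_pos k (by omega : (0 : ℤ) < q)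
    omega
  have hk := Int.mul_ediv_add_emod k q
  rw [hr] at hk
  generalize hd : k / (q : ℤ) = d at hk
  obtain ⟨h1, h2, h3, h4, h5⟩ := ho r hrq
  have hprev : ((k - 1) % q).toNat = (r + (q - 1)) % q := by
    have : (k - 1) % q = ((r + (q - 1)) % q : ℕ) := by
      push_cast [Nat.cast_sub hq]
      rw [← hk, show (q : ℤ) * d + r - 1 = (r + (q - 1)) + q * (d - 1) by ring,
        Int.add_mul_emod_self_left]
    rw [this, Int.toNat_natCast]
  simp only [hr, hd, Int.toNat_natCast, hprev]
  refine ⟨hQ _ ?_, h1, ?_, ?_, fun j hj hj' => ?_⟩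
  · rw [List.getD_eq_getElem _ _ (by omega)]
    exact List.getElem_mem _
  · rcases (show r + 1 < q ∨ r + 1 = q by omega) with hlt | heq
    · have e : k + 1 = (r + 1 : ℕ) + q * d := by push_cast; rw [← hk]; ring
      rw [e, Int.add_mul_emod_self_left, Int.add_mul_ediv_left _ _ (by omega),
        Int.emod_eq_of_lt (by omega) (by omega), Int.ediv_eq_zero_of_lt (by omega) (by omega),
        Int.toNat_natCast, h2]
      push_cast [show 1 ≤ (Q.getD r []).length by omega]
      ring
    · have e : k + 1 = q * (d + 1) := by rw [← hk, ← heq]; push_cast; ring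
      rw [e, Int.mul_emod_right, Int.mul_ediv_cancel_left _ (by omega), Int.toNat_zero, ho0]
      rw [heq, hoQ] at h2
      have h6 : (w.length : ℤ) = o.getD r 0 + ((Q.getD r []).length - 1) := by
        rw [h2]; push_cast [show 1 ≤ (Q.getD r []).length by omega]; ring
      push_cast
      linarith
  · rw [h _ _ (by omega), h4]
  · rw [← h5 j (by omega) hj hj', ← h d _ (by omega)]
    congr 1; push_cast; ring

lemma isQuiddity_one_one_one : IsQuiddity [1, 1, 1] := .ear 0 0 [] .base

lemma isQuiddity_pentagon : IsQuiddity [2, 1, 3, 1, 2] :=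
  .rotate 2 [2, 1, 3, 1] (.rotate 1 [2, 2, 1, 3] (.rotate 3 [1, 2, 2, 1]
    (.ear 2 1 [2, 1] (.ear 1 1 [1] isQuiddity_one_one_one))))

/-- The periods in the table belong to affine sequences. -/
lemma AffineTable.isAffineSeq {t : BicharTriple ℂ} {w : List ℕ} (h : AffineTable t w) {c : ℤ → ℕ}
    (hc : HasPeriodWord c w) : IsAffineSeq c := by
  have hw : w ∈ [[2], [1, 4], [2, 3, 1, 3], [4, 1, 3, 3, 1], [6, 1, 3, 1]] := by
    cases h <;> simp
  have h2 := IsQuiddity.base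
  have h3 := isQuiddity_one_one_one
  have h5 := isQuiddity_pentagon
  simp only [List.mem_cons, List.not_mem_nil, or_false] at hw
  obtain rfl | rfl | rfl | rfl | rfl := hw
  · exact hc.isAffineSeq [[0, 0]] [0, 1] (by simp [h2]) (by simp) rfl rfl (by decide)
  · have hc' : HasPeriodWord c [4, 1] := by
      obtain ⟨s, hs⟩ := hc
      refine ⟨s + 1, fun n j hj => ?_⟩
      have hj' : j < 2 := hj
      interval_cases j
      · exact (congrArg c (by simp; ring)).trans (hs n 1 (by simp))
      · exact (congrArg c (by simp; ring)).trans (hs (n + 1) 0 (by simp))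
    exact hc'.isAffineSeq [[1, 1, 1]] [0, 2] (by simp [h3]) (by simp) rfl rfl (by decide)
  · exact hc.isAffineSeq [[0, 0], [1, 1, 1], [0, 0]] [0, 1, 3, 4] (by simp [h2, h3]) (by simp) rfl
      rfl (by decide)
  · exact hc.isAffineSeq [[1, 1, 1], [0, 0], [1, 1, 1]] [0, 2, 3, 5] (by simp [h2, h3]) (by simp) rfl
      rfl (by decide)
  · exact hc.isAffineSeq [[2, 1, 3, 1, 2]] [0, 4] (by simp [h5]) (by simp) rfl rfl (by decide)

open BicharTriple in
theorem mainTheorem6 (t : BicharTriple ℂ) :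
    (t.IsAffine ↔ ∃ w : List ℕ, AffineTable t w ∨ AffineTable t.swap w) ∧
    (∀ w : List ℕ, AffineTable t w ∨ AffineTable t.swap w →
      ∀ c : ℤ → ℕ, t.IsCharSeq c → HasPeriodWord c w) := by
  refine ⟨⟨?_, ?_⟩, fun w hw c hc => ?_⟩
  · rintro ⟨c, hc, ha⟩
    obtain ⟨S, rfl, h⟩ := isCharSeq_iff.1 hc
    obtain ⟨τ, p, hτ⟩ := ha.exists_isTreeSeq
    -- a triple of the chain is in the table, and hence all of them are
    have key : ∀ i, InTable (S i) → InTable (S 0) := by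
      rintro i ⟨w, hw⟩
      obtain ⟨S', c', h0, h', hS', -⟩ := hasTableOrbit hw
      have := ((h.comp_add i).unique h' (by simp [h0])).2
      have h1 := hS' (-i)
      rw [← this] at h1
      simpa using h1
    obtain ⟨w, hw, i, hi | hi⟩ := hτ.exists_keyWord
    · exact key i (h.inTable_of_checkWord (fun i l => hτ.staysPositive i) hi (checkWord_of_mem hw))
    · have := h.comp_neg.inTable_of_checkWord (fun i l => hτ.comp_neg.staysPositive i) hi
        (checkWord_of_mem hw)
      exact key _ this.swap
  · rintro ⟨w, hw⟩
    obtain ⟨S, c, h0, h, -, hp⟩ := hasTableOrbit hw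
    refine ⟨c, isCharSeq_iff.2 ⟨S, h0, h⟩, ?_⟩
    obtain hw | hw := hw <;> exact hw.isAffineSeq hp
  · obtain ⟨S, rfl, h⟩ := isCharSeq_iff.1 hc
    obtain ⟨S', c', h0, h', -, hp⟩ := hasTableOrbit hw
    rwa [(h.unique h' h0.symm).1]
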